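/- **Theorem 1.5.** Let $PG$ be the Petersen graph, with vertices $u_i,v_i$ ($i\in\mathbb Z/5$) and edges $u_iu_{i+1}$, $u_iv_i$, $v_iv_{i+2}$, regarded as a topological space in the usual way. Let $f:PG\to\mathbb R^2$ be a plane generic immersion, that is, an immersion (a continuous, locally injective map) whose multiple points are only finitely many transversal double points between edges: every point of the plane with more than one preimage has exactly two preimages, there are only finitely many such points, their preimages are not vertices of $PG$, and at each of them the two branches of $f$ cross transversally (in suitable local homeomorphic coordinates of the plane around the point, one branch lies in the first coordinate axis and the other in the second). For a subgraph $H$ of $PG$ let $c(f(H))$ be the number of crossings (double points) of the restriction $f|_H$, and let $\Gamma_k(PG)$ be the set of all $k$-cycles of $PG$, i.e. of all subgraphs that are cycles with $k$ edges. Then $$\sum_{\gamma\in\Gamma_5(PG)}c(f(\gamma))\equiv\sum_{\gamma\in\Gamma_6(PG)}c(f(\gamma))\equiv\sum_{\gamma\in\Gamma_9(PG)}c(f(\gamma))\equiv 1\pmod 2$$ and $$\sum_{\gamma\in\Gamma_8(PG)}c(f(\gamma))\equiv 0\pmod 4.$$ -/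

import Mathlib

open scoped Topology

namespace PlaneGraph

/-- The Petersen graph. The vertices are `u i = Sum.inl i` and `v i = Sum.inr i` with `i` modulo `5`,
the edges are `u i — u (i+1)`, `u i — v i` and `v i — v (i+2)`. -/
def petersen : SimpleGraph (ZMod 5 ⊕ ZMod 5) where
  Adj
    | Sum.inl i, Sum.inl j => j = i + 1 ∨ i = j + 1
    | Sum.inl i, Sum.inr j => i = j
    | Sum.inr i, Sum.inl j => i = j
    | Sum.inr i, Sum.inr j => j = i + 2 ∨ i = j + 2
  symm := ⟨by
    rintro (i | i) (j | j) h
    · exact h.symm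
    · exact h.symm
    · exact h.symm
    · exact h.symm⟩
  loopless := ⟨by
    rintro (i | i) h
    · revert h; revert i; decide
    · revert h; revert i; decide⟩

section

variable {V : Type*} [DecidableEq V] {G : SimpleGraph V}

/-- The subgraph `H`, as a topological space: the vertices of the graph are the standard basis
vectors of `V → ℝ`, and an edge `uv` is the straight segment joining the basis vectors of `u`
and `v`. (For a finite vertex set this is the usual topological realization.) -/
def space (H : G.Subgraph) : Set (V → ℝ) :=
  {x | ∃ v ∈ H.verts, x = Pi.single v 1} ∪
    {x | ∃ u v, H.Adj u v ∧ x ∈ segment ℝ (Pi.single u 1) (Pi.single v 1)}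

variable (G) in
/-- The whole graph `G` as a topological space. -/
abbrev Space : Type _ := space (⊤ : G.Subgraph)

/-- The point `x` of the graph is a vertex. -/
def IsVertex (x : Space G) : Prop := ∃ v : V, x.1 = Pi.single v 1

/-- The branches of `f` at the points `x` and `x'`, which have the same image, cross transversally
there: some local homeomorphic coordinates of the plane around `f x = f x'` map the branch through
`x` into the first coordinate axis and the branch through `x'` into the second one.
For locally injective `f` (and `x`, `x'` not vertices) the branches then fill
neighbourhoods of the origin in the two axes. For continuously differentiable branches, linear
independence of the two velocities gives such coordinates (inverse function theorem). -/
def CrossTransversally (f : Space G → EuclideanSpace ℝ (Fin 2)) (x x' : Space G) : Prop :=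
  ∃ φ : OpenPartialHomeomorph (EuclideanSpace ℝ (Fin 2)) (ℝ × ℝ),
    f x ∈ φ.source ∧ φ (f x) = (0, 0) ∧ f x' = f x ∧
    (∀ᶠ z in 𝓝 x, (φ (f z)).2 = 0) ∧ (∀ᶠ z in 𝓝 x', (φ (f z)).1 = 0)

/-- Plane generic immersions of a finite graph: immersions of the graph (a one-dimensional complex)
into the plane whose multiple points are only finitely many transversal double points
between edges. -/
structure IsPlaneGenericImmersion (f : Space G → EuclideanSpace ℝ (Fin 2)) : Prop where
  continuous : Continuous f
  locally_injective : ∀ x, ∃ U ∈ 𝓝 x, Set.InjOn f U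
  finite_multiple : {y | (f ⁻¹' {y}).Nontrivial}.Finite
  double : ∀ y, (f ⁻¹' {y}).Nontrivial → (f ⁻¹' {y}).ncard = 2
  not_isVertex : ∀ x x', x ≠ x' → f x = f x' → ¬ IsVertex x
  transversal : ∀ x x', x ≠ x' → f x = f x' → CrossTransversally f x x'

/-- `c(f(H))`: the number of crossings of the restriction of `f` to the subgraph `H`, that is,
of points of the plane with at least two preimages in `H`. -/
noncomputable def crossings (f : Space G → EuclideanSpace ℝ (Fin 2)) (H : G.Subgraph) : ℕ :=
  {y | ∃ x x' : Space G, x.1 ∈ space H ∧ x'.1 ∈ space H ∧ x ≠ x' ∧ f x = y ∧ f x' = y}.ncard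

end

/-- The set of all `k`-cycles of a finite graph `G`. A cycle is a subgraph, so
that the base point and the direction in which it is traversed do not matter. -/
noncomputable def cycles {V : Type*} [Finite V] (G : SimpleGraph V) (k : ℕ) :
    Finset G.Subgraph :=
  (Set.toFinite
    {H : G.Subgraph | ∃ (v : V) (p : G.Walk v v),
      p.IsCycle ∧ p.length = k ∧ H = p.toSubgraph}).toFinset

end PlaneGraph

/-! A crossing lies on a cycle exactly when the cycle contains the edges that cross there, so each
sum equals the sum over all crossings of the number of `k`-cycles through the two edges
(`sum_crossings_cycles`). Enumerating the cycles shows that for `k = 8` this number is a multiple of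
4 for every pair of edges, equal edges included, which settles that case. For `k = 5, 6, 9` it is
odd exactly for close pairs: disjoint edges joined by an edge. It remains to see that close edges
have an odd total number of crossings.

This is a van Kampen type invariant, obtained here without deforming the immersion. For disjoint
edges `α`, `β` the crossings are the zeros of `α s - β t` on the unit square. Transversality makes
each index odd (`exists_half_square_logs`, a local form of Borsuk's theorem on odd maps), so the
winding number around the square has the parity of the number of crossings. Each side of the square
compares an edge with a vertex; hence this parity is a sum of edge-vertex terms and of terms
depending only on a numbering of the vertices
(`IsPlaneGenericImmersion.exists_ncard_edgeCrossings_eq`). Over all close pairs the edge-vertex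
terms cancel, because a vertex off an edge lies on exactly two edges close to it, and the order
terms add up to 1. -/

theorem Convex.exists_continuousOn_exp_eq {E : Type*} [NormedAddCommGroup E] [NormedSpace ℝ E]
    {C : Set E} (hC : Convex ℝ C) {F : E → ℂ} (hF : ContinuousOn F C) (h0 : ∀ x ∈ C, F x ≠ 0) :
    ∃ L : E → ℂ, ContinuousOn L C ∧ ∀ x ∈ C, Complex.exp (L x) = F x := by
  classical
  rcases C.eq_empty_or_nonempty with rfl | hne
  · exact ⟨0, continuousOn_const, by simp⟩
  have := hC.contractibleSpace hne
  have := hC.locallyPathConnectedSpace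
  obtain ⟨x₀, hx₀⟩ := hne
  -- A convex set is contractible and locally path connected, so `F` lifts through the covering
  -- `exp`.
  obtain ⟨L, ⟨-, hL⟩, -⟩ := Complex.isCoveringMapOn_exp.existsUnique_continuousMap_lifts
    (A := C) ⟨fun x => F x, hF.domRestrict⟩ (a₀ := ⟨x₀, hx₀⟩) (e₀ := Complex.log (F x₀))
    (Complex.exp_log (h0 _ hx₀)) (fun a => h0 _ a.2)
  refine ⟨fun x => if h : x ∈ C then L ⟨x, h⟩ else 0, ?_, fun x hx => ?_⟩
  · rw [continuousOn_iff_continuous_domRestrict]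
    convert L.continuous using 1
    ext x
    simp [Set.domRestrict]
  · simp only [hx, dif_pos]
    exact congrFun hL ⟨x, hx⟩

/-! ### Logarithms in units of `π * I` and winding numbers around rectangles -/

namespace PlaneGraph

/-- `L` is a continuous logarithm of `F` on `C`, in units of `π * I`. -/
structure IsLogOn {X : Type*} [TopologicalSpace X] (L F : X → ℂ) (C : Set X) : Prop where
  continuousOn : ContinuousOn L C
  exp_eq : ∀ x ∈ C, Complex.exp (Real.pi * Complex.I * L x) = F x

theorem pi_mul_I_ne_zero : (Real.pi * Complex.I : ℂ) ≠ 0 := by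
  simp [Real.pi_ne_zero]

theorem exp_pi_eq_iff {x y : ℂ} :
    Complex.exp (Real.pi * Complex.I * x) = Complex.exp (Real.pi * Complex.I * y) ↔
      ∃ n : ℤ, x = y + 2 * n := by
  rw [Complex.exp_eq_exp_iff_exists_int]
  refine exists_congr fun n => ⟨fun h => mul_left_cancel₀ pi_mul_I_ne_zero ?_, fun h => ?_⟩
  · linear_combination h
  · rw [h]; ring

/-- In these units a sign change is a shift by 1 while the ambiguity is a shift by 2; the odd local
index comes from this difference. -/
theorem exp_pi_add_one (x : ℂ) : Complex.exp (Real.pi * Complex.I * (x + 1)) =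
    -Complex.exp (Real.pi * Complex.I * x) := by
  rw [mul_add, Complex.exp_add, mul_one, Complex.exp_pi_mul_I, mul_neg_one]

theorem exists_isLogOn {E : Type*} [NormedAddCommGroup E] [NormedSpace ℝ E]
    {C : Set E} (hC : Convex ℝ C) {F : E → ℂ} (hF : ContinuousOn F C) (h0 : ∀ x ∈ C, F x ≠ 0) :
    ∃ L, IsLogOn L F C := by
  obtain ⟨L, hL, h⟩ := hC.exists_continuousOn_exp_eq hF h0
  refine ⟨fun x => L x / (Real.pi * Complex.I), hL.div_const _, fun x hx => ?_⟩
  rw [mul_div_cancel₀ _ pi_mul_I_ne_zero, h x hx]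

section

variable {X Y : Type*} [TopologicalSpace X] [TopologicalSpace Y] {L L' F : X → ℂ} {C D : Set X}

theorem IsLogOn.mono (h : IsLogOn L F C) (hD : D ⊆ C) : IsLogOn L F D :=
  ⟨h.1.mono hD, fun x hx => h.2 x (hD hx)⟩

theorem IsLogOn.congr {F' : X → ℂ} (h : IsLogOn L F C) (hF : ∀ x ∈ C, F' x = F x) :
    IsLogOn L F' C :=
  ⟨h.1, fun x hx => (h.2 x hx).trans (hF x hx).symm⟩

theorem IsLogOn.comp (h : IsLogOn L F C) {g : Y → X} {B : Set Y} (hg : ContinuousOn g B)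
    (hB : Set.MapsTo g B C) : IsLogOn (L ∘ g) (F ∘ g) B :=
  ⟨h.1.comp hg hB, fun _ hx => h.2 _ (hB hx)⟩

theorem IsLogOn.neg (h : IsLogOn L F C) : IsLogOn (fun x => L x + 1) (fun x => -F x) C :=
  ⟨h.1.add continuousOn_const, fun x hx => by rw [exp_pi_add_one, h.2 x hx]⟩

/-- After a shift by an even integer the two logarithms agree at one point, and lifts through `exp`
that agree at one point of a preconnected set coincide. -/
theorem IsLogOn.exists_int (h : IsLogOn L F C) (h' : IsLogOn L' F C) (hC : IsPreconnected C) :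
    ∃ n : ℤ, ∀ x ∈ C, L x = L' x + 2 * n := by
  rcases C.eq_empty_or_nonempty with rfl | ⟨x₀, hx₀⟩
  · exact ⟨0, by simp⟩
  obtain ⟨n, hn⟩ := exp_pi_eq_iff.1 ((h.2 x₀ hx₀).trans (h'.2 x₀ hx₀).symm)
  refine ⟨n, fun x hx => ?_⟩
  have key := Complex.isCoveringMap_exp.eqOn_of_comp_eqOn hC
    (g₁ := fun x => Real.pi * Complex.I * L x)
    (g₂ := fun x => Real.pi * Complex.I * (L' x + 2 * n))
    (continuousOn_const.mul h.1) (continuousOn_const.mul (h'.1.add continuousOn_const))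
    (fun _ hy => Subtype.ext ?_) hx₀ (by rw [hn]) hx
  · exact mul_left_cancel₀ pi_mul_I_ne_zero key
  · simp only [Function.comp]
    rw [h.2 _ hy, ← h'.2 _ hy]
    exact exp_pi_eq_iff.2 ⟨-n, by push_cast; ring⟩

end

/-- The variation over `[a, b]` of a continuous logarithm of `F`, in units of `π * I`. -/
noncomputable def logVar (F : ℝ → ℂ) (a b : ℝ) : ℂ :=
  open Classical in
  if h : ∃ L, IsLogOn L F (Set.Icc a b) then h.choose b - h.choose a else 0

theorem IsLogOn.logVar_eq {L F : ℝ → ℂ} {a b : ℝ} (h : IsLogOn L F (Set.Icc a b)) (hab : a ≤ b) :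
    logVar F a b = L b - L a := by
  have h' : ∃ L, IsLogOn L F (Set.Icc a b) := ⟨L, h⟩
  rw [logVar, dif_pos h']
  obtain ⟨n, hn⟩ := h'.choose_spec.exists_int h isPreconnected_Icc
  rw [hn b (Set.right_mem_Icc.2 hab), hn a (Set.left_mem_Icc.2 hab)]
  ring

theorem logVar_add {F : ℝ → ℂ} {a b c : ℝ} (hab : a ≤ b) (hbc : b ≤ c)
    (hF : ContinuousOn F (Set.Icc a c)) (h0 : ∀ x ∈ Set.Icc a c, F x ≠ 0) :
    logVar F a c = logVar F a b + logVar F b c := by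
  obtain ⟨L, hL⟩ := exists_isLogOn (convex_Icc a c) hF h0
  rw [hL.logVar_eq (hab.trans hbc), (hL.mono (Set.Icc_subset_Icc_right hbc)).logVar_eq hab,
    (hL.mono (Set.Icc_subset_Icc_left hab)).logVar_eq hbc]
  ring

theorem logVar_neg {F : ℝ → ℂ} {a b : ℝ} (hab : a ≤ b)
    (hF : ContinuousOn F (Set.Icc a b)) (h0 : ∀ x ∈ Set.Icc a b, F x ≠ 0) :
    logVar (fun x => -F x) a b = logVar F a b := by
  obtain ⟨L, hL⟩ := exists_isLogOn (convex_Icc a b) hF h0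
  rw [hL.logVar_eq hab, hL.neg.logVar_eq hab]
  ring

/-- Any logarithms of the end values determine the variation modulo 2. -/
theorem exists_logVar_eq {F : ℝ → ℂ} {a b : ℝ} (hab : a ≤ b)
    (hF : ContinuousOn F (Set.Icc a b)) (h0 : ∀ x ∈ Set.Icc a b, F x ≠ 0) {x y : ℂ}
    (hx : Complex.exp (Real.pi * Complex.I * x) = F a)
    (hy : Complex.exp (Real.pi * Complex.I * y) = F b) :
    ∃ n : ℤ, logVar F a b = y - x + 2 * n := by
  obtain ⟨L, hL⟩ := exists_isLogOn (convex_Icc a b) hF h0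
  rw [← hL.2 a (Set.left_mem_Icc.2 hab)] at hx
  rw [← hL.2 b (Set.right_mem_Icc.2 hab)] at hy
  obtain ⟨n, hn⟩ := exp_pi_eq_iff.1 hx
  obtain ⟨m, hm⟩ := exp_pi_eq_iff.1 hy
  refine ⟨n - m, ?_⟩
  rw [hL.logVar_eq hab, hn, hm]
  push_cast
  ring

/-- The variation of a logarithm of `F` around the boundary of `[a, b] × [c, d]`, in units of
`π * I`; this is twice the winding number. -/
noncomputable def winding (F : ℝ → ℝ → ℂ) (a b c d : ℝ) : ℂ :=
  logVar (fun s => F s c) a b + logVar (F b) c d - logVar (fun s => F s d) a b - logVar (F a) c d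

section

variable {F : ℝ → ℝ → ℂ} (hF : Continuous fun p : ℝ × ℝ => F p.1 p.2) {a b b' c d d' : ℝ}

include hF

/-- One logarithm on the whole rectangle serves all four sides, and its corner values cancel. -/
theorem winding_eq_zero (hab : a ≤ b) (hcd : c ≤ d)
    (h0 : ∀ s ∈ Set.Icc a b, ∀ t ∈ Set.Icc c d, F s t ≠ 0) : winding F a b c d = 0 := by
  obtain ⟨L, hL⟩ := exists_isLogOn ((convex_Icc a b).prod (convex_Icc c d)) hF.continuousOn
    (fun p hp => h0 p.1 hp.1 p.2 hp.2)
  have hs : ∀ t ∈ Set.Icc c d, logVar (fun s => F s t) a b = L (b, t) - L (a, t) := fun t ht =>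
    (hL.comp (g := fun s => (s, t)) (by fun_prop) (fun s hs => ⟨hs, ht⟩)).logVar_eq hab
  have ht : ∀ s ∈ Set.Icc a b, logVar (F s) c d = L (s, d) - L (s, c) := fun s hs =>
    (hL.comp (g := fun t => (s, t)) (by fun_prop) (fun t ht => ⟨hs, ht⟩)).logVar_eq hcd
  rw [winding, hs c (Set.left_mem_Icc.2 hcd), hs d (Set.right_mem_Icc.2 hcd),
    ht a (Set.left_mem_Icc.2 hab), ht b (Set.right_mem_Icc.2 hab)]
  ring

theorem winding_add_left (hab : a ≤ b) (hbb : b ≤ b')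
    (hc : ∀ s ∈ Set.Icc a b', F s c ≠ 0) (hd : ∀ s ∈ Set.Icc a b', F s d ≠ 0) :
    winding F a b' c d = winding F a b c d + winding F b b' c d := by
  have h : ∀ t, Continuous fun s => F s t := fun t =>
    hF.comp (Continuous.prodMk continuous_id continuous_const)
  simp only [winding]
  rw [logVar_add hab hbb (h c).continuousOn hc, logVar_add hab hbb (h d).continuousOn hd]
  ring

theorem winding_add_right (hcd : c ≤ d) (hdd : d ≤ d')
    (ha : ∀ t ∈ Set.Icc c d', F a t ≠ 0) (hb : ∀ t ∈ Set.Icc c d', F b t ≠ 0) :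
    winding F a b c d' = winding F a b c d + winding F a b d d' := by
  have h : ∀ s, Continuous (F s) := fun s =>
    hF.comp (Continuous.prodMk continuous_const continuous_id)
  simp only [winding]
  rw [logVar_add hcd hdd (h a).continuousOn ha, logVar_add hcd hdd (h b).continuousOn hb]
  ring

end

open Set

/-! ### The local index of a transversal crossing -/

section

variable {ψ : ℝ × ℝ → ℂ} {r : ℝ}

/-- The homotopy from `(x, y) ↦ ψ (x, 0) - ψ (0, y)` to an odd map which translates both points
by the same vector. -/
noncomputable def oddHomotopy (ψ : ℝ × ℝ → ℂ) (p : ℝ × ℝ × ℝ) : ℂ :=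
  -- At time `t` both arguments are translated by `-(t/2)(x, y)`. Their difference stays `(x, -y)`,
  -- and at `t = 1` they are negatives of each other.
  ψ (p.1 * (1 - p.2.2 / 2), -(p.2.1 * (p.2.2 / 2))) -
    ψ (-(p.1 * (p.2.2 / 2)), p.2.1 * (1 - p.2.2 / 2))

theorem oddHomotopy_zero (x y : ℝ) : oddHomotopy ψ (x, y, 0) = ψ (x, 0) - ψ (0, y) := by
  simp [oddHomotopy]

theorem oddHomotopy_one_neg (x y : ℝ) :
    oddHomotopy ψ (-x, -y, 1) = -oddHomotopy ψ (x, y, 1) := by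
  simp only [oddHomotopy, neg_sub]
  congr 3 <;> ring

theorem mul_mem_Ioo_of_mem_Icc {x l : ℝ} (hx : x ∈ Ioo (-r) r) (hl : l ∈ Icc (0 : ℝ) 1) :
    x * l ∈ Ioo (-r) r := by
  rw [mem_Ioo, ← abs_lt] at *
  rw [abs_mul, abs_of_nonneg hl.1]
  nlinarith [abs_nonneg x, hl.2]

/-- The two arguments of `ψ` differ by `(x, -y)`, so injectivity keeps the homotopy away from 0 as
long as `(x, y) ≠ 0`. -/
theorem exists_isLogOn_oddHomotopy
    (hψ : ContinuousOn ψ (Ioo (-r) r ×ˢ Ioo (-r) r)) (hinj : InjOn ψ (Ioo (-r) r ×ˢ Ioo (-r) r))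
    {I J : Set ℝ} (hI : Convex ℝ I) (hJ : Convex ℝ J) (hI' : I ⊆ Ioo (-r) r)
    (hJ' : J ⊆ Ioo (-r) r) (h0 : ∀ x ∈ I, ∀ y ∈ J, (x, y) ≠ 0) :
    ∃ L, IsLogOn L (oddHomotopy ψ) (I ×ˢ J ×ˢ Icc (0 : ℝ) 1) := by
  have h1 : ∀ p ∈ I ×ˢ J ×ˢ Icc (0 : ℝ) 1,
      (p.1 * (1 - p.2.2 / 2), -(p.2.1 * (p.2.2 / 2))) ∈ Ioo (-r) r ×ˢ Ioo (-r) r := by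
    rintro ⟨x, y, t⟩ ⟨hx, hy, ht⟩
    have := mul_mem_Ioo_of_mem_Icc (hJ' hy) (l := t / 2) ⟨by linarith [ht.1], by linarith [ht.2]⟩
    exact ⟨mul_mem_Ioo_of_mem_Icc (hI' hx) ⟨by linarith [ht.2], by linarith [ht.1]⟩,
      by linarith [this.2], by linarith [this.1]⟩
  have h2 : ∀ p ∈ I ×ˢ J ×ˢ Icc (0 : ℝ) 1,
      (-(p.1 * (p.2.2 / 2)), p.2.1 * (1 - p.2.2 / 2)) ∈ Ioo (-r) r ×ˢ Ioo (-r) r := by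
    rintro ⟨x, y, t⟩ ⟨hx, hy, ht⟩
    have := mul_mem_Ioo_of_mem_Icc (hI' hx) (l := t / 2) ⟨by linarith [ht.1], by linarith [ht.2]⟩
    exact ⟨⟨by linarith [this.2], by linarith [this.1]⟩,
      mul_mem_Ioo_of_mem_Icc (hJ' hy) ⟨by linarith [ht.2], by linarith [ht.1]⟩⟩
  refine exists_isLogOn (hI.prod (hJ.prod (convex_Icc 0 1))) ?_ fun p hp h => ?_
  · exact (hψ.comp (by fun_prop) h1).sub (hψ.comp (by fun_prop) h2)
  · have := hinj (h1 p hp) (h2 p hp) (sub_eq_zero.1 h)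
    rw [Prod.mk.injEq] at this
    refine h0 p.1 hp.1 p.2.1 hp.2.1 (Prod.ext ?_ ?_)
    · simp only [Prod.fst_zero]; linarith [this.1]
    · simp only [Prod.snd_zero]; linarith [this.2]

/-- An injective continuous map `ψ` on a square has odd local index along the axes: the logarithms
of `ψ (x, 0) - ψ (0, y)` on the four half squares do not match. -/
theorem exists_half_square_logs (hr : 0 < r)
    (hψ : ContinuousOn ψ (Ioo (-r) r ×ˢ Ioo (-r) r))
    (hinj : InjOn ψ (Ioo (-r) r ×ˢ Ioo (-r) r)) :
    ∃ S N E W : ℝ × ℝ → ℂ, ∃ p q u v : ℤ, Odd (p + q + u + v) ∧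
      IsLogOn S (fun z => ψ (z.1, 0) - ψ (0, z.2)) (Ioo (-r) r ×ˢ Ioo (-r) 0) ∧
      IsLogOn N (fun z => ψ (z.1, 0) - ψ (0, z.2)) (Ioo (-r) r ×ˢ Ioo 0 r) ∧
      IsLogOn E (fun z => ψ (z.1, 0) - ψ (0, z.2)) (Ioo 0 r ×ˢ Ioo (-r) r) ∧
      IsLogOn W (fun z => ψ (z.1, 0) - ψ (0, z.2)) (Ioo (-r) 0 ×ˢ Ioo (-r) r) ∧
      (∀ z ∈ Ioo 0 r ×ˢ Ioo (-r) 0, S z = E z + 2 * p) ∧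
      (∀ z ∈ Ioo 0 r ×ˢ Ioo 0 r, E z = N z + 2 * q) ∧
      (∀ z ∈ Ioo (-r) 0 ×ˢ Ioo 0 r, N z = W z + 2 * u) ∧
      (∀ z ∈ Ioo (-r) 0 ×ˢ Ioo (-r) 0, W z = S z + 2 * v) := by
  have hA : Ioo (-r) r ⊆ Ioo (-r) r := Subset.rfl
  have hP : Ioo 0 r ⊆ Ioo (-r) r := Ioo_subset_Ioo_left (by linarith)
  have hM : Ioo (-r) 0 ⊆ Ioo (-r) r := Ioo_subset_Ioo_right hr.le
  have cv : ∀ a b : ℝ, Convex ℝ (Ioo a b) := convex_Ioo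
  obtain ⟨S, hS⟩ := exists_isLogOn_oddHomotopy hψ hinj (cv (-r) r) (cv (-r) 0) hA hM
    (fun x _ y hy h => hy.2.ne (congrArg Prod.snd h))
  obtain ⟨N, hN⟩ := exists_isLogOn_oddHomotopy hψ hinj (cv (-r) r) (cv 0 r) hA hP
    (fun x _ y hy h => hy.1.ne' (congrArg Prod.snd h))
  obtain ⟨E, hE⟩ := exists_isLogOn_oddHomotopy hψ hinj (cv 0 r) (cv (-r) r) hP hA
    (fun x hx y _ h => hx.1.ne' (congrArg Prod.fst h))
  obtain ⟨W, hW⟩ := exists_isLogOn_oddHomotopy hψ hinj (cv (-r) 0) (cv (-r) r) hM hA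
    (fun x hx y _ h => hx.2.ne (congrArg Prod.fst h))
  have pc : ∀ a b c d : ℝ, IsPreconnected (Ioo a b ×ˢ Ioo c d ×ˢ Icc (0 : ℝ) 1) :=
    fun a b c d => ((cv a b).prod ((cv c d).prod (convex_Icc 0 1))).isPreconnected
  -- Neighbouring half squares overlap in a quadrant. The jumps there do not depend on the homotopy
  -- parameter, so they can be evaluated at time 1 although they are needed at time 0.
  obtain ⟨p, hp⟩ := (hS.mono (prod_mono_left hP)).exists_int
    (hE.mono (prod_mono_right (prod_mono_left hM))) (pc 0 r (-r) 0)
  obtain ⟨q, hq⟩ := (hE.mono (prod_mono_right (prod_mono_left hP))).exists_int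
    (hN.mono (prod_mono_left hP)) (pc 0 r 0 r)
  obtain ⟨u, hu⟩ := (hN.mono (prod_mono_left hM)).exists_int
    (hW.mono (prod_mono_right (prod_mono_left hP))) (pc (-r) 0 0 r)
  obtain ⟨v, hv⟩ := (hW.mono (prod_mono_right (prod_mono_left hM))).exists_int
    (hS.mono (prod_mono_left hM)) (pc (-r) 0 (-r) 0)
  have h0 : (0 : ℝ) ∈ Icc (0 : ℝ) 1 := ⟨le_rfl, zero_le_one⟩
  have h1 : (1 : ℝ) ∈ Icc (0 : ℝ) 1 := ⟨zero_le_one, le_rfl⟩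
  have restrict : ∀ {L : ℝ × ℝ × ℝ → ℂ} {I J : Set ℝ},
      IsLogOn L (oddHomotopy ψ) (I ×ˢ J ×ˢ Icc (0 : ℝ) 1) →
      IsLogOn (fun z : ℝ × ℝ => L (z.1, z.2, 0)) (fun z => ψ (z.1, 0) - ψ (0, z.2)) (I ×ˢ J) := by
    intro L I J h
    refine IsLogOn.congr (h.comp (g := fun z : ℝ × ℝ => (z.1, z.2, 0)) (by fun_prop)
      fun z hz => ⟨hz.1, hz.2, h0⟩) fun z _ => ?_
    exact (oddHomotopy_zero z.1 z.2).symm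
  have antipode : ∀ {L L' : ℝ × ℝ × ℝ → ℂ} {I J I' J' : Set ℝ} (_ : Convex ℝ I) (_ : Convex ℝ J)
      (_ : ∀ x ∈ I, -x ∈ I') (_ : ∀ x ∈ J, -x ∈ J'),
      IsLogOn L (oddHomotopy ψ) (I ×ˢ J ×ˢ Icc (0 : ℝ) 1) →
      IsLogOn L' (oddHomotopy ψ) (I' ×ˢ J' ×ˢ Icc (0 : ℝ) 1) →
      ∃ n : ℤ, ∀ x ∈ I, ∀ y ∈ J, L' (-x, -y, 1) = L (x, y, 1) + 1 + 2 * n := by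
    intro L L' I J I' J' hI hJ hI' hJ' h h'
    have k := (h.comp (g := fun z : ℝ × ℝ => (z.1, z.2, 1)) (B := I ×ˢ J) (by fun_prop)
      fun z hz => ⟨hz.1, hz.2, h1⟩).neg
    have k' := h'.comp (g := fun z : ℝ × ℝ => (-z.1, -z.2, 1)) (B := I ×ˢ J) (by fun_prop)
      fun z hz => ⟨hI' _ hz.1, hJ' _ hz.2, h1⟩
    obtain ⟨n, hn⟩ := (k'.congr (F' := fun z => -oddHomotopy ψ (z.1, z.2, 1))
      fun z _ => (oddHomotopy_one_neg z.1 z.2).symm).exists_int k (hI.prod hJ).isPreconnected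
    exact ⟨n, fun x hx y hy => hn (x, y) ⟨hx, hy⟩⟩
  have nA : ∀ x ∈ Ioo (-r) r, -x ∈ Ioo (-r) r := fun x hx =>
    ⟨by linarith [hx.2], by linarith [hx.1]⟩
  have nP : ∀ x ∈ Ioo 0 r, -x ∈ Ioo (-r) 0 := fun x hx =>
    ⟨by linarith [hx.2], by linarith [hx.1]⟩
  obtain ⟨i, hi⟩ := antipode (cv _ _) (cv _ _) nA nP hN hS
  obtain ⟨j, hj⟩ := antipode (cv _ _) (cv _ _) nP nA hE hW
  refine ⟨_, _, _, _, p, q, u, v, ?_, restrict hS, restrict hN, restrict hE, restrict hW,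
    fun z hz => hp _ ⟨hz.1, hz.2, h0⟩, fun z hz => hq _ ⟨hz.1, hz.2, h0⟩,
    fun z hz => hu _ ⟨hz.1, hz.2, h0⟩, fun z hz => hv _ ⟨hz.1, hz.2, h0⟩⟩
  have hρ : r / 2 ∈ Ioo 0 r := ⟨by linarith, by linarith⟩
  have hρ' : -(r / 2) ∈ Ioo (-r) 0 := nP _ hρ
  have e1 := hp (r / 2, -(r / 2), 1) ⟨hρ, hρ', h1⟩
  have e2 := hq (r / 2, r / 2, 1) ⟨hρ, hρ, h1⟩
  have e3 := hu (-(r / 2), r / 2, 1) ⟨hρ', hρ, h1⟩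
  have e4 := hv (-(r / 2), -(r / 2), 1) ⟨hρ', hρ', h1⟩
  have f1 := hi (-(r / 2)) (hM hρ') (r / 2) hρ
  have f2 := hi (r / 2) (hP hρ) (r / 2) hρ
  have f3 := hj (r / 2) hρ (-(r / 2)) (hM hρ')
  have f4 := hj (r / 2) hρ (r / 2) (hP hρ)
  rw [neg_neg] at f1 f3
  -- Antipodal symmetry at time 1 gives `u = p - i - j - 1` and `v = q + j - i`, so `j` cancels and
  -- the sum is odd.
  have key : ((p + q + u + v : ℤ) : ℂ) = ((2 * (p + q - i - 1) + 1 : ℤ) : ℂ) := by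
    push_cast
    linear_combination (1 / 2 : ℂ) * (e1 + e2 - e3 - e4 - f1 - f2 - f3 + f4)
  exact ⟨p + q - i - 1, Int.cast_injective key⟩

end

section

variable {ψ : ℝ × ℝ → ℂ} {r : ℝ} {α β : ℝ → ℂ} {a b : ℝ → ℝ} {s₁ s₂ t₁ t₂ : ℝ}

/-- The bottom, right, top and left sides of the rectangle lie over the half squares of `S`, `E`,
`N`, `W`. With these logarithms the corner values cancel up to the four jumps, whose sum is odd. -/
theorem odd_winding_of_neg_of_pos (hψ : ContinuousOn ψ (Ioo (-r) r ×ˢ Ioo (-r) r))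
    (hinj : InjOn ψ (Ioo (-r) r ×ˢ Ioo (-r) r)) (hs : s₁ ≤ s₂) (ht : t₁ ≤ t₂)
    (ha : ContinuousOn a (Icc s₁ s₂)) (ha' : MapsTo a (Icc s₁ s₂) (Ioo (-r) r))
    (hα : ∀ s ∈ Icc s₁ s₂, α s = ψ (a s, 0))
    (hb : ContinuousOn b (Icc t₁ t₂)) (hb' : MapsTo b (Icc t₁ t₂) (Ioo (-r) r))
    (hβ : ∀ t ∈ Icc t₁ t₂, β t = ψ (0, b t))
    (ha₁ : a s₁ < 0) (ha₂ : 0 < a s₂) (hb₁ : b t₁ < 0) (hb₂ : 0 < b t₂) :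
    ∃ m : ℤ, Odd m ∧ winding (fun s t => α s - β t) s₁ s₂ t₁ t₂ = 2 * m := by
  have ms₁ : s₁ ∈ Icc s₁ s₂ := left_mem_Icc.2 hs
  have ms₂ : s₂ ∈ Icc s₁ s₂ := right_mem_Icc.2 hs
  have mt₁ : t₁ ∈ Icc t₁ t₂ := left_mem_Icc.2 ht
  have mt₂ : t₂ ∈ Icc t₁ t₂ := right_mem_Icc.2 ht
  have hr : 0 < r := ha₂.trans (ha' ms₂).2
  obtain ⟨S, N, E, W, p, q, u, v, hodd, hS, hN, hE, hW, hp, hq, hu, hv⟩ :=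
    exists_half_square_logs hr hψ hinj
  have horizontal : ∀ {L : ℝ × ℝ → ℂ} {J : Set ℝ} {t : ℝ}, t ∈ Icc t₁ t₂ → b t ∈ J →
      IsLogOn L (fun z => ψ (z.1, 0) - ψ (0, z.2)) (Ioo (-r) r ×ˢ J) →
      logVar (fun s => α s - β t) s₁ s₂ = L (a s₂, b t) - L (a s₁, b t) := by
    intro L J t ht' hJ h
    refine IsLogOn.logVar_eq (L := fun s => L (a s, b t)) ?_ hs
    refine IsLogOn.congr (h.comp (g := fun s => (a s, b t)) (by fun_prop)
      fun s hs' => ⟨ha' hs', hJ⟩) fun s hs' => ?_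
    rw [hα s hs', hβ t ht']
    rfl
  have vertical : ∀ {L : ℝ × ℝ → ℂ} {I : Set ℝ} {s : ℝ}, s ∈ Icc s₁ s₂ → a s ∈ I →
      IsLogOn L (fun z => ψ (z.1, 0) - ψ (0, z.2)) (I ×ˢ Ioo (-r) r) →
      logVar (fun t => α s - β t) t₁ t₂ = L (a s, b t₂) - L (a s, b t₁) := by
    intro L I s hs' hI h
    refine IsLogOn.logVar_eq (L := fun t => L (a s, b t)) ?_ ht
    refine IsLogOn.congr (h.comp (g := fun t => (a s, b t)) (by fun_prop)
      fun t ht' => ⟨hI, hb' ht'⟩) fun t ht' => ?_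
    rw [hα s hs', hβ t ht']
    rfl
  have ia₁ : a s₁ ∈ Ioo (-r) 0 := ⟨(ha' ms₁).1, ha₁⟩
  have ia₂ : a s₂ ∈ Ioo 0 r := ⟨ha₂, (ha' ms₂).2⟩
  have ib₁ : b t₁ ∈ Ioo (-r) 0 := ⟨(hb' mt₁).1, hb₁⟩
  have ib₂ : b t₂ ∈ Ioo 0 r := ⟨hb₂, (hb' mt₂).2⟩
  refine ⟨p + q + u + v, hodd, ?_⟩
  rw [winding, horizontal mt₁ ib₁ hS, horizontal mt₂ ib₂ hN, vertical ms₁ ia₁ hW,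
    vertical ms₂ ia₂ hE, hp (a s₂, b t₁) ⟨ia₂, ib₁⟩, hq (a s₂, b t₂) ⟨ia₂, ib₂⟩,
    hu (a s₁, b t₂) ⟨ia₁, ib₂⟩, hv (a s₁, b t₁) ⟨ia₁, ib₁⟩]
  push_cast
  ring

/-- The winding number around a topologically transversal crossing of two branches is odd. -/
theorem odd_winding_of_mul_neg (hψ : ContinuousOn ψ (Ioo (-r) r ×ˢ Ioo (-r) r))
    (hinj : InjOn ψ (Ioo (-r) r ×ˢ Ioo (-r) r)) (hs : s₁ ≤ s₂) (ht : t₁ ≤ t₂)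
    (ha : ContinuousOn a (Icc s₁ s₂)) (ha' : MapsTo a (Icc s₁ s₂) (Ioo (-r) r))
    (hα : ∀ s ∈ Icc s₁ s₂, α s = ψ (a s, 0))
    (hb : ContinuousOn b (Icc t₁ t₂)) (hb' : MapsTo b (Icc t₁ t₂) (Ioo (-r) r))
    (hβ : ∀ t ∈ Icc t₁ t₂, β t = ψ (0, b t))
    (ha₀ : a s₁ * a s₂ < 0) (hb₀ : b t₁ * b t₂ < 0) :
    ∃ m : ℤ, Odd m ∧ winding (fun s t => α s - β t) s₁ s₂ t₁ t₂ = 2 * m := by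
  have neg_mem : ∀ {x : ℝ}, x ∈ Ioo (-r) r → -x ∈ Ioo (-r) r := fun hx =>
    ⟨by linarith [hx.2], by linarith [hx.1]⟩
  -- Reflecting a chart coordinate changes `ψ` and `a` but neither curve, so the winding number
  -- stays the same.
  wlog h : a s₁ < 0 generalizing ψ a
  · refine this (ψ := fun z => ψ (-z.1, z.2)) (a := fun s => -a s)
      (hψ.comp (by fun_prop) fun z hz => ⟨neg_mem hz.1, hz.2⟩) (fun z hz w hw h => ?_) ha.neg
      (fun s hs => neg_mem (ha' hs)) (fun s hs => by simp only [neg_neg]; exact hα s hs)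
      (fun t ht => by simp only [neg_zero]; exact hβ t ht) (by linarith) ?_
    · have := hinj (x₁ := (-z.1, z.2)) ⟨neg_mem hz.1, hz.2⟩ (x₂ := (-w.1, w.2))
        ⟨neg_mem hw.1, hw.2⟩ h
      rw [Prod.mk.injEq, neg_inj] at this
      exact Prod.ext this.1 this.2
    · have : a s₁ ≠ 0 := fun h0 => by simp [h0] at ha₀
      exact neg_lt_zero.2 (lt_of_le_of_ne (not_lt.1 h) this.symm)
  wlog h' : b t₁ < 0 generalizing ψ b
  · refine this (ψ := fun z => ψ (z.1, -z.2)) (b := fun s => -b s)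
      hb.neg (fun s hs => neg_mem (hb' hs)) (by linarith)
      (hψ.comp (by fun_prop) fun z hz => ⟨hz.1, neg_mem hz.2⟩) (fun z hz w hw h => ?_)
      (fun s hs => by simp only [neg_zero]; exact hα s hs)
      (fun t ht => by simp only [neg_neg]; exact hβ t ht) ?_
    · have := hinj (x₁ := (z.1, -z.2)) ⟨hz.1, neg_mem hz.2⟩ (x₂ := (w.1, -w.2))
        ⟨hw.1, neg_mem hw.2⟩ h
      rw [Prod.mk.injEq, neg_inj] at this
      exact Prod.ext this.1 this.2
    · have : b t₁ ≠ 0 := fun h0 => by simp [h0] at hb₀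
      exact neg_lt_zero.2 (lt_of_le_of_ne (not_lt.1 h') this.symm)
  exact odd_winding_of_neg_of_pos hψ hinj hs ht ha ha' hα hb hb' hβ h
    (pos_of_mul_neg_right ha₀ h.le) h' (pos_of_mul_neg_right hb₀ h'.le)

end

/-! ### Counting zeros by the winding number -/

/-- The winding number around a rectangle has the parity of the number of zeros, if all of them have
odd index and no two of them lie on a vertical line. -/
theorem exists_winding_eq_card {F : ℝ → ℝ → ℂ} (hF : Continuous fun p : ℝ × ℝ => F p.1 p.2)
    {c d : ℝ} (hcd : c ≤ d) {Z : Finset (ℝ × ℝ)} {a b : ℝ} (hab : a ≤ b)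
    (hZ : ∀ s ∈ Icc a b, ∀ t ∈ Icc c d, F s t = 0 → (s, t) ∈ Z)
    (hZ' : ∀ z ∈ Z, z ∈ Ioo a b ×ˢ Ioo c d)
    (hfst : InjOn Prod.fst (Z : Set (ℝ × ℝ)))
    (hodd : ∀ z ∈ Z, ∀ᶠ δ in 𝓝[>] (0 : ℝ), ∃ m : ℤ, Odd m ∧
      winding F (z.1 - δ) (z.1 + δ) (z.2 - δ) (z.2 + δ) = 2 * m) :
    ∃ m : ℤ, (m : ZMod 2) = Z.card ∧ winding F a b c d = 2 * m := by
  induction hn : Z.card using Nat.strong_induction_on generalizing Z a b with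
  | _ n ih =>
  subst hn
  rcases Z.eq_empty_or_nonempty with rfl | ⟨z, hz⟩
  · refine ⟨0, by simp, ?_⟩
    rw [winding_eq_zero hF hab hcd fun s hs t ht h => by simpa using hZ s hs t ht h]
    simp
  obtain ⟨s₀, t₀⟩ := z
  obtain ⟨⟨hs1, hs2⟩, ht1, ht2⟩ := hZ' _ hz
  dsimp only at hs1 hs2 ht1 ht2
  have small : ∀ x : ℝ, 0 < x → ∀ᶠ δ in 𝓝[>] (0 : ℝ), δ < x := fun x hx =>
    nhdsWithin_le_nhds (eventually_lt_nhds hx)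
  -- The strip of half width `δ` around the line through the chosen zero must contain no other zero;
  -- the rectangles to its left and right are left to induction.
  have hsep : ∀ᶠ δ in 𝓝[>] (0 : ℝ), ∀ w ∈ Z, w ≠ (s₀, t₀) → δ < |w.1 - s₀| := by
    rw [Finset.eventually_all]
    intro w hw
    by_cases h : w = (s₀, t₀)
    · simp [h]
    · filter_upwards [small |w.1 - s₀| (abs_pos.2 (sub_ne_zero.2 fun h' => h (hfst hw hz h')))]
        with δ hδ _ using hδ
  obtain ⟨δ, ⟨m₀, hm₀, hw₀⟩, h1, h2, h3, h4, hsepδ, hδ⟩ := ((hodd _ hz).and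
    ((small _ (sub_pos.2 hs1)).and ((small _ (sub_pos.2 hs2)).and ((small _ (sub_pos.2 ht1)).and
    ((small _ (sub_pos.2 ht2)).and (hsep.and self_mem_nhdsWithin)))))).exists
  replace hδ : 0 < δ := hδ
  dsimp only at hw₀
  set Z₁ := Z.filter fun w => w.1 < s₀ with hZ₁
  set Z₂ := Z.filter fun w => s₀ < w.1 with hZ₂
  have hcard : Z.card = Z₁.card + 1 + Z₂.card := by
    have e0 : (Z.filter fun w => ¬ w.1 < s₀) = insert (s₀, t₀) Z₂ := by
      ext w
      simp only [Finset.mem_filter, Finset.mem_insert, hZ₂, not_lt]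
      constructor
      · rintro ⟨h, h'⟩
        rcases h'.eq_or_lt with h'' | h''
        · exact Or.inl (hfst h hz h''.symm)
        · exact Or.inr ⟨h, h''⟩
      · rintro (rfl | h)
        · exact ⟨hz, le_rfl⟩
        · exact ⟨h.1, h.2.le⟩
    rw [← Finset.card_filter_add_card_filter_not (s := Z) (fun w => w.1 < s₀), e0,
      Finset.card_insert_of_notMem (by simp [hZ₂])]
    ring
  have hne : ∀ s ∈ Icc a b, ∀ t ∈ Icc c d, s ∈ Icc (s₀ - δ) (s₀ + δ) → (s, t) ≠ (s₀, t₀) →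
      F s t ≠ 0 := by
    intro s hs t ht hs' hne h0
    exact (hsepδ _ (hZ s hs t ht h0) hne).not_ge (abs_sub_le_iff.2
      ⟨by linarith [hs'.2], by linarith [hs'.1]⟩)
  have side : ∀ x ∈ Icc c d, x ∉ Ioo c d → ∀ s ∈ Icc a b, F s x ≠ 0 := by
    intro x hx hx' s hs h0
    exact hx' (hZ' _ (hZ s hs x hx h0)).2
  have sidec := side c (left_mem_Icc.2 hcd) (by simp)
  have sided := side d (right_mem_Icc.2 hcd) (by simp)
  have i1 : Icc a (s₀ - δ) ⊆ Icc a b := Icc_subset_Icc_right (by linarith)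
  have i2 : Icc (s₀ + δ) b ⊆ Icc a b := Icc_subset_Icc_left (by linarith)
  have i3 : Icc (s₀ - δ) b ⊆ Icc a b := Icc_subset_Icc_left (by linarith)
  have i4 : Icc (s₀ - δ) (s₀ + δ) ⊆ Icc a b := Icc_subset_Icc (by linarith) (by linarith)
  obtain ⟨m₁, hm₁, hw₁⟩ := ih Z₁.card (by omega) (Z := Z₁) (a := a) (b := s₀ - δ) (by linarith)
    (fun s hs t ht h0 => Finset.mem_filter.2 ⟨hZ s (i1 hs) t ht h0, by
      simp only; linarith [hs.2]⟩)
    (fun w hw => by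
      rw [hZ₁, Finset.mem_filter] at hw
      have h5 := hZ' w hw.1
      have h6 := hsepδ w hw.1 fun h => hw.2.ne (congrArg Prod.fst h)
      rw [abs_of_neg (by linarith [hw.2])] at h6
      exact ⟨⟨h5.1.1, by linarith⟩, h5.2⟩)
    (hfst.mono (Finset.coe_subset.2 (Finset.filter_subset _ _)))
    (fun w hw => hodd w (Finset.filter_subset _ _ hw)) rfl
  obtain ⟨m₂, hm₂, hw₂⟩ := ih Z₂.card (by omega) (Z := Z₂) (a := s₀ + δ) (b := b) (by linarith)
    (fun s hs t ht h0 => Finset.mem_filter.2 ⟨hZ s (i2 hs) t ht h0, by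
      simp only; linarith [hs.1]⟩)
    (fun w hw => by
      rw [hZ₂, Finset.mem_filter] at hw
      have h5 := hZ' w hw.1
      have h6 := hsepδ w hw.1 fun h => hw.2.ne' (congrArg Prod.fst h)
      rw [abs_of_pos (by linarith [hw.2])] at h6
      exact ⟨⟨by linarith, h5.1.2⟩, h5.2⟩)
    (hfst.mono (Finset.coe_subset.2 (Finset.filter_subset _ _)))
    (fun w hw => hodd w (Finset.filter_subset _ _ hw)) rfl
  have vert : ∀ x ∈ Icc (s₀ - δ) (s₀ + δ), x ≠ s₀ → ∀ t ∈ Icc c d, F x t ≠ 0 :=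
    fun x hx hx' t ht => hne x (i4 hx) t ht hx fun h => hx' (congrArg Prod.fst h)
  have vl := vert (s₀ - δ) ⟨le_rfl, by linarith⟩ (by linarith)
  have vr := vert (s₀ + δ) ⟨by linarith, le_rfl⟩ (by linarith)
  -- Below and above the small square the strip has no zeros, so only the index of the chosen zero
  -- remains.
  have hmid : winding F (s₀ - δ) (s₀ + δ) c d = 2 * m₀ := by
    rw [winding_add_right hF (d := t₀ - δ) (by linarith) (by linarith) vl vr,
      winding_add_right hF (c := t₀ - δ) (d := t₀ + δ) (by linarith) (by linarith)
        (fun t ht => vl t ⟨by linarith [ht.1], ht.2⟩)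
        (fun t ht => vr t ⟨by linarith [ht.1], ht.2⟩), hw₀,
      winding_eq_zero hF (by linarith) (by linarith) fun s hs t ht => hne s (i4 hs) t
        ⟨ht.1, by linarith [ht.2]⟩ hs fun h => ?_,
      winding_eq_zero hF (by linarith) (by linarith) fun s hs t ht => hne s (i4 hs) t
        ⟨by linarith [ht.1], ht.2⟩ hs fun h => ?_]
    · ring
    · have := congrArg Prod.snd h
      simp only at this
      linarith [ht.1]
    · have := congrArg Prod.snd h
      simp only at this
      linarith [ht.2]
  refine ⟨m₁ + m₀ + m₂, ?_, ?_⟩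
  · rw [hcard]
    push_cast
    rw [hm₁, hm₂, ZMod.intCast_eq_one_iff_odd.2 hm₀]
  · rw [winding_add_left hF (b := s₀ - δ) (by linarith) (by linarith) sidec sided,
      winding_add_left hF (a := s₀ - δ) (b := s₀ + δ) (by linarith) (by linarith)
        (fun s hs => sidec s (i3 hs)) (fun s hs => sided s (i3 hs)), hw₁, hmid, hw₂]
    push_cast
    ring

/-! ### Parametrized edges and the plane as `ℂ` -/

section

variable {V : Type*} [DecidableEq V] {G : SimpleGraph V} {u v c d : V}

/-- The vertex `v` as a point of the graph. -/
def vertexPt (G : SimpleGraph V) (v : V) : Space G :=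
  ⟨Pi.single v 1, Or.inl ⟨v, trivial, rfl⟩⟩

/-- The parametrization of the edge `uv`, constant outside `[0, 1]`. -/
noncomputable def edgePt (h : G.Adj u v) (t : ℝ) : Space G :=
  ⟨AffineMap.lineMap (Pi.single u 1 : V → ℝ) (Pi.single v 1) (projIcc 0 1 zero_le_one t : ℝ),
    Or.inr ⟨u, v, h, by
      rw [segment_eq_image_lineMap]
      exact mem_image_of_mem _ (projIcc 0 1 zero_le_one t).2⟩⟩

theorem edgePt_coe (h : G.Adj u v) (t : ℝ) : (edgePt h t).1 =
    AffineMap.lineMap (Pi.single u 1 : V → ℝ) (Pi.single v 1) (projIcc 0 1 zero_le_one t : ℝ) :=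
  rfl

theorem continuous_edgePt (h : G.Adj u v) : Continuous (edgePt h) := by
  refine Continuous.subtype_mk ?_ _
  exact AffineMap.lineMap_continuous.comp (continuous_subtype_val.comp continuous_projIcc)

theorem edgePt_val (h : G.Adj u v) {t : ℝ} (ht : t ∈ Icc (0 : ℝ) 1) :
    (edgePt h t).1 = AffineMap.lineMap (Pi.single u 1 : V → ℝ) (Pi.single v 1) t := by
  rw [edgePt_coe, projIcc_of_mem _ ht]

theorem edgePt_apply_left (h : G.Adj u v) {t : ℝ} (ht : t ∈ Icc (0 : ℝ) 1) :
    (edgePt h t).1 u = 1 - t := by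
  rw [edgePt_val h ht, AffineMap.lineMap_apply_module]
  simp [h.ne]

theorem edgePt_apply_right (h : G.Adj u v) {t : ℝ} (ht : t ∈ Icc (0 : ℝ) 1) :
    (edgePt h t).1 v = t := by
  rw [edgePt_val h ht, AffineMap.lineMap_apply_module]
  simp [h.ne']

theorem edgePt_apply_of_ne (h : G.Adj u v) (t : ℝ) {w : V} (hu : w ≠ u) (hv : w ≠ v) :
    (edgePt h t).1 w = 0 := by
  rw [edgePt_coe, AffineMap.lineMap_apply_module]
  simp [hu, hv]

theorem edgePt_zero (h : G.Adj u v) : edgePt h 0 = vertexPt G u :=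
  Subtype.ext (by rw [edgePt_val h ⟨le_rfl, zero_le_one⟩]; simp [vertexPt])

theorem edgePt_one (h : G.Adj u v) : edgePt h 1 = vertexPt G v :=
  Subtype.ext (by rw [edgePt_val h ⟨zero_le_one, le_rfl⟩]; simp [vertexPt])

theorem isVertex_vertexPt (v : V) : IsVertex (vertexPt G v) := ⟨v, rfl⟩

theorem vertexPt_injective : Function.Injective (vertexPt G) := by
  intro p q h
  by_contra hne
  have := congrFun (congrArg Subtype.val h) p
  simp [vertexPt, hne] at this

theorem injOn_edgePt (h : G.Adj u v) : InjOn (edgePt h) (Icc 0 1) := by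
  intro s hs t ht hst
  rw [← edgePt_apply_right h hs, ← edgePt_apply_right h ht, hst]

/-- The coordinates at `u` and `v` add up to 1 on the edge `uv`, and both vanish on an edge disjoint
from it. -/
theorem edgePt_ne_edgePt (h : G.Adj u v) (h' : G.Adj c d) (huc : u ≠ c) (hud : u ≠ d) (hvc : v ≠ c)
    (hvd : v ≠ d) {s : ℝ} (hs : s ∈ Icc (0 : ℝ) 1) (t : ℝ) : edgePt h s ≠ edgePt h' t := by
  intro he
  have h1 := edgePt_apply_left h hs
  have h2 := edgePt_apply_right h hs
  rw [he, edgePt_apply_of_ne h' t huc hud] at h1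
  rw [he, edgePt_apply_of_ne h' t hvc hvd] at h2
  linarith

/-- The identification of the plane with the complex numbers. -/
noncomputable def planeToComplex : EuclideanSpace ℝ (Fin 2) ≃ₗᵢ[ℝ] ℂ :=
  Complex.orthonormalBasisOneI.repr.symm

theorem continuous_planeToComplex : Continuous planeToComplex :=
  planeToComplex.continuous

theorem planeToComplex_injective : Function.Injective planeToComplex :=
  planeToComplex.injective

end

/-! ### Crossing parities of disjoint edges -/

section

variable {X : Type*} [TopologicalSpace X]

/-- A locally injective curve which runs in an axis of a chart changes the side of the origin. -/
theorem eventually_mul_neg_of_chart (φ : OpenPartialHomeomorph X (ℝ × ℝ)) {γ : ℝ → X}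
    (hγ : Continuous γ) {s₀ : ℝ} (hs₀ : γ s₀ ∈ φ.source) {U : Set ℝ} (hU : U ∈ 𝓝 s₀)
    (hinj : InjOn γ U) {g : ℝ × ℝ → ℝ} (hg : Continuous g) {ι : ℝ → ℝ × ℝ}
    (hι : ∀ᶠ s in 𝓝 s₀, φ (γ s) = ι (g (φ (γ s)))) (h0 : g (φ (γ s₀)) = 0) {r : ℝ} (hr : 0 < r) :
    ∀ᶠ δ in 𝓝[>] (0 : ℝ), ContinuousOn (fun s => g (φ (γ s))) (Icc (s₀ - δ) (s₀ + δ)) ∧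
      MapsTo (fun s => g (φ (γ s))) (Icc (s₀ - δ) (s₀ + δ)) (Ioo (-r) r) ∧
      (∀ s ∈ Icc (s₀ - δ) (s₀ + δ), γ s = φ.symm (ι (g (φ (γ s))))) ∧
      g (φ (γ (s₀ - δ))) * g (φ (γ (s₀ + δ))) < 0 := by
  have hsrc : ∀ᶠ s in 𝓝 s₀, γ s ∈ φ.source :=
    hγ.continuousAt.eventually (φ.open_source.mem_nhds hs₀)
  have hcont : ∀ s, γ s ∈ φ.source → ContinuousAt (fun s => g (φ (γ s))) s := fun s hs =>
    hg.continuousAt.comp ((φ.continuousAt hs).comp hγ.continuousAt)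
  have hr' : ∀ᶠ s in 𝓝 s₀, g (φ (γ s)) ∈ Ioo (-r) r := by
    refine (hcont s₀ hs₀).eventually (Ioo_mem_nhds ?_ ?_) <;> simp only [h0] <;> linarith
  obtain ⟨ε, hε, hall⟩ := Metric.eventually_nhds_iff.1 (((hsrc.and hι).and hr').and hU)
  have hlt : ∀ᶠ δ in 𝓝[>] (0 : ℝ), δ < ε := nhdsWithin_le_nhds (eventually_lt_nhds hε)
  filter_upwards [hlt, self_mem_nhdsWithin] with δ hδ hδ0
  replace hδ0 : 0 < δ := hδ0
  have hall' : ∀ s ∈ Icc (s₀ - δ) (s₀ + δ),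
      ((γ s ∈ φ.source ∧ φ (γ s) = ι (g (φ (γ s)))) ∧ g (φ (γ s)) ∈ Ioo (-r) r) ∧ s ∈ U := by
    intro s hs
    refine hall ?_
    rw [Real.dist_eq]
    exact (abs_sub_le_iff.2 ⟨by linarith [hs.2], by linarith [hs.1]⟩).trans_lt hδ
  have hc : ContinuousOn (fun s => g (φ (γ s))) (Icc (s₀ - δ) (s₀ + δ)) := fun s hs =>
    (hcont s (hall' s hs).1.1.1).continuousWithinAt
  refine ⟨hc, fun s hs => (hall' s hs).1.2, fun s hs => ?_, ?_⟩
  · rw [← (hall' s hs).1.1.2, φ.left_inv (hall' s hs).1.1.1]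
  -- On the axis the coordinate `g` determines the point, so it inherits local injectivity from `γ`;
  -- being continuous on an interval, it is then strictly monotone and changes sign at its zero.
  have hi : InjOn (fun s => g (φ (γ s))) (Icc (s₀ - δ) (s₀ + δ)) := by
    intro s hs t ht hst
    obtain ⟨⟨⟨h1, h2⟩, -⟩, h3⟩ := hall' s hs
    obtain ⟨⟨⟨h1', h2'⟩, -⟩, h3'⟩ := hall' t ht
    refine hinj h3 h3' (φ.injOn h1 h1' ?_)
    rw [h2, h2']
    exact congrArg ι hst
  have ml : s₀ - δ ∈ Icc (s₀ - δ) (s₀ + δ) := ⟨le_rfl, by linarith⟩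
  have mm : s₀ ∈ Icc (s₀ - δ) (s₀ + δ) := ⟨by linarith, by linarith⟩
  have mr : s₀ + δ ∈ Icc (s₀ - δ) (s₀ + δ) := ⟨by linarith, le_rfl⟩
  rcases hc.strictMonoOn_of_injOn_Icc' (by linarith) hi with hm | hm
  · have h1 := hm ml mm (by linarith)
    have h2 := hm mm mr (by linarith)
    simp only [h0] at h1 h2
    exact mul_neg_of_neg_of_pos h1 h2
  · have h1 := hm ml mm (by linarith)
    have h2 := hm mm mr (by linarith)
    simp only [h0] at h1 h2
    exact mul_neg_of_pos_of_neg h1 h2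

end

section

variable {V : Type*} [DecidableEq V] {G : SimpleGraph V} {u v c d : V}
  {f : Space G → EuclideanSpace ℝ (Fin 2)}

/-- The image of the edge `uv` as a curve in the complex plane. -/
noncomputable def edgeCurve (f : Space G → EuclideanSpace ℝ (Fin 2)) (h : G.Adj u v) (t : ℝ) : ℂ :=
  planeToComplex (f (edgePt h t))

/-- The image of the vertex `v` in the complex plane. -/
noncomputable def vertexImage (f : Space G → EuclideanSpace ℝ (Fin 2)) (v : V) : ℂ :=
  planeToComplex (f (vertexPt G v))

theorem IsPlaneGenericImmersion.continuous_edgeCurve (hf : IsPlaneGenericImmersion f)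
    (h : G.Adj u v) : Continuous (edgeCurve f h) :=
  continuous_planeToComplex.comp (hf.continuous.comp (continuous_edgePt h))

theorem IsPlaneGenericImmersion.exists_injOn_edge (hf : IsPlaneGenericImmersion f)
    (h : G.Adj u v) {s : ℝ} (hs : s ∈ Ioo (0 : ℝ) 1) :
    ∃ U ∈ 𝓝 s, InjOn (fun s => f (edgePt h s)) U := by
  obtain ⟨U, hU, hinj⟩ := hf.locally_injective (edgePt h s)
  refine ⟨edgePt h ⁻¹' U ∩ Ioo 0 1, Filter.inter_mem ((continuous_edgePt h).continuousAt hU)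
    (isOpen_Ioo.mem_nhds hs), fun x hx y hy hxy => ?_⟩
  exact injOn_edgePt h (Ioo_subset_Icc_self hx.2) (Ioo_subset_Icc_self hy.2)
    (hinj hx.1 hy.1 hxy)

/-- The inverse of the transversality chart plays the role of `ψ`, and the chart coordinates of the
two branches along their axes are `a` and `b`. -/
theorem IsPlaneGenericImmersion.eventually_odd_winding (hf : IsPlaneGenericImmersion f)
    (h : G.Adj u v) (h' : G.Adj c d) {s t : ℝ} (hs : s ∈ Ioo (0 : ℝ) 1) (ht : t ∈ Ioo (0 : ℝ) 1)
    (hne : edgePt h s ≠ edgePt h' t) (heq : f (edgePt h s) = f (edgePt h' t)) :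
    ∀ᶠ δ in 𝓝[>] (0 : ℝ), ∃ m : ℤ, Odd m ∧
      winding (fun s t => edgeCurve f h s - edgeCurve f h' t) (s - δ) (s + δ) (t - δ) (t + δ) =
        2 * m := by
  obtain ⟨φ, hsrc, h0, -, h1, h2⟩ := hf.transversal _ _ hne heq
  have htgt : φ.target ∈ 𝓝 ((0, 0) : ℝ × ℝ) := φ.open_target.mem_nhds (h0 ▸ φ.map_source hsrc)
  obtain ⟨r, hr, hball⟩ := Metric.mem_nhds_iff.1 htgt
  rw [← ball_prod_same, Real.ball_eq_Ioo, zero_sub, zero_add] at hball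
  obtain ⟨U, hU, hUi⟩ := hf.exists_injOn_edge h hs
  obtain ⟨U', hU', hUi'⟩ := hf.exists_injOn_edge h' ht
  have hcu := eventually_mul_neg_of_chart φ (hf.continuous.comp (continuous_edgePt h)) hsrc hU hUi
    continuous_fst (ι := fun x => (x, 0))
    (((continuous_edgePt h).continuousAt.eventually h1).mono fun s hs => Prod.ext rfl hs)
    (by simp only [Function.comp]; rw [h0]) hr
  have hcc := eventually_mul_neg_of_chart φ (hf.continuous.comp (continuous_edgePt h'))
    (by simp only [Function.comp]; rwa [← heq]) hU' hUi'
    continuous_snd (ι := fun x => (0, x))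
    (((continuous_edgePt h').continuousAt.eventually h2).mono fun s hs => Prod.ext hs rfl)
    (by simp only [Function.comp]; rw [← heq, h0]) hr
  filter_upwards [hcu, hcc, self_mem_nhdsWithin] with δ hδ hδ' hδ0
  replace hδ0 : 0 < δ := hδ0
  obtain ⟨a1, a2, a3, a4⟩ := hδ
  obtain ⟨b1, b2, b3, b4⟩ := hδ'
  refine odd_winding_of_mul_neg (ψ := fun z => planeToComplex (φ.symm z)) (r := r)
    (continuous_planeToComplex.comp_continuousOn (φ.continuousOn_symm.mono hball))
    (planeToComplex_injective.comp_injOn (φ.symm.injOn.mono hball)) (by linarith) (by linarith)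
    a1 a2 (fun s hs => ?_) b1 b2 (fun s hs => ?_) a4 b4
  · exact congrArg planeToComplex (a3 s hs)
  · exact congrArg planeToComplex (b3 s hs)

/-- The points where the images of two edges meet. -/
def edgeCrossings (f : Space G → EuclideanSpace ℝ (Fin 2)) (h : G.Adj u v) (h' : G.Adj c d) :
    Set (EuclideanSpace ℝ (Fin 2)) :=
  {y | ∃ s ∈ Icc (0 : ℝ) 1, ∃ t ∈ Icc (0 : ℝ) 1, f (edgePt h s) = y ∧ f (edgePt h' t) = y}

theorem IsPlaneGenericImmersion.eq_of_ne_of_ne (hf : IsPlaneGenericImmersion f) {x x' z : Space G}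
    (hxz : x ≠ z) (hxz' : x' ≠ z) (h : f x = f z) (h' : f x' = f z) : x = x' := by
  obtain ⟨p, q, hpq, hset⟩ := ncard_eq_two.1 (hf.double (f z) ⟨x, h, z, rfl, hxz⟩)
  have hx : x ∈ f ⁻¹' {f z} := h
  have hx' : x' ∈ f ⁻¹' {f z} := h'
  have hz : z ∈ f ⁻¹' {f z} := rfl
  rw [hset] at hx hx' hz
  simp only [mem_insert_iff, mem_singleton_iff] at hx hx' hz
  grind

/-- As multiple points are double, zeros in the unit square correspond to crossings and no two share
the first parameter; as they avoid vertices, no zero is on the boundary. -/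
theorem IsPlaneGenericImmersion.exists_winding_eq_ncard (hf : IsPlaneGenericImmersion f)
    (h : G.Adj u v) (h' : G.Adj c d) (huc : u ≠ c) (hud : u ≠ d) (hvc : v ≠ c) (hvd : v ≠ d) :
    ∃ m : ℤ, (m : ZMod 2) = (edgeCrossings f h h').ncard ∧
      winding (fun s t => edgeCurve f h s - edgeCurve f h' t) 0 1 0 1 = 2 * m := by
  have hne : ∀ s ∈ Icc (0 : ℝ) 1, ∀ t, edgePt h s ≠ edgePt h' t :=
    fun s hs t => edgePt_ne_edgePt h h' huc hud hvc hvd hs t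
  set Z : Set (ℝ × ℝ) := {p | p ∈ Icc (0 : ℝ) 1 ×ˢ Icc (0 : ℝ) 1 ∧
    f (edgePt h p.1) = f (edgePt h' p.2)} with hZdef
  have himage : (fun p : ℝ × ℝ => f (edgePt h p.1)) '' Z = edgeCrossings f h h' := by
    ext y
    constructor
    · rintro ⟨p, hp, rfl⟩
      exact ⟨p.1, hp.1.1, p.2, hp.1.2, rfl, hp.2.symm⟩
    · rintro ⟨s, hs, t, ht, h1, h2⟩
      exact ⟨(s, t), ⟨⟨hs, ht⟩, h1.trans h2.symm⟩, h1⟩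
  have hinj : InjOn (fun p : ℝ × ℝ => f (edgePt h p.1)) Z := by
    rintro ⟨s, t⟩ ⟨⟨hs, ht⟩, he⟩ ⟨s', t'⟩ ⟨⟨hs', ht'⟩, he'⟩ (hy : f (edgePt h s) = f (edgePt h s'))
    dsimp only at hs ht hs' ht' he he'
    refine Prod.ext (injOn_edgePt h hs hs' ?_) (injOn_edgePt h' ht ht' ?_)
    · exact hf.eq_of_ne_of_ne (hne s hs t) (hne s' hs' t) he (hy.symm.trans he)
    · exact hf.eq_of_ne_of_ne (hne s hs t).symm (hne s hs t').symm he.symm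
        (he'.symm.trans hy.symm)
  have hfin : Z.Finite := by
    refine Finite.of_finite_image (hf.finite_multiple.subset ?_) hinj
    rintro _ ⟨p, hp, rfl⟩
    exact ⟨_, rfl, _, hp.2.symm, hne _ hp.1.1 _⟩
  have hinterior : ∀ {x : ℝ}, x ∈ Icc (0 : ℝ) 1 → x ≠ 0 → x ≠ 1 → x ∈ Ioo (0 : ℝ) 1 :=
    fun hx h0 h1 => ⟨lt_of_le_of_ne hx.1 h0.symm, lt_of_le_of_ne hx.2 h1⟩
  have hZ' : ∀ p ∈ Z, p ∈ Ioo (0 : ℝ) 1 ×ˢ Ioo (0 : ℝ) 1 := by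
    rintro ⟨s, t⟩ ⟨⟨hs, ht⟩, he⟩
    have n1 := hf.not_isVertex _ _ (hne s hs t) he
    have n2 := hf.not_isVertex _ _ (hne s hs t).symm he.symm
    refine ⟨hinterior hs ?_ ?_, hinterior ht ?_ ?_⟩ <;> rintro rfl
    · exact n1 (edgePt_zero h ▸ isVertex_vertexPt u)
    · exact n1 (edgePt_one h ▸ isVertex_vertexPt v)
    · exact n2 (edgePt_zero h' ▸ isVertex_vertexPt c)
    · exact n2 (edgePt_one h' ▸ isVertex_vertexPt d)
  have hcard : hfin.toFinset.card = (edgeCrossings f h h').ncard := by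
    rw [← himage, hinj.ncard_image, ncard_eq_toFinset_card _ hfin]
  rw [← hcard]
  refine exists_winding_eq_card ?_ zero_le_one zero_le_one
    (fun s hs t ht h0 => hfin.mem_toFinset.2 ⟨⟨hs, ht⟩, planeToComplex_injective
      (sub_eq_zero.1 h0)⟩)
    (fun z hz => hZ' z (hfin.mem_toFinset.1 hz)) ?_ (fun z hz => ?_)
  · have := hf.continuous_edgeCurve h
    have := hf.continuous_edgeCurve h'
    fun_prop
  · rw [hfin.coe_toFinset]
    intro z hz w hw hzw
    exact hinj hz hw (congrArg (fun s => f (edgePt h s)) hzw)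
  · have hz' := hfin.mem_toFinset.1 hz
    exact hf.eventually_odd_winding h h' (hZ' z hz').1 (hZ' z hz').2 (hne _ hz'.1.1 _) hz'.2

theorem IsPlaneGenericImmersion.vertexImage_injective (hf : IsPlaneGenericImmersion f) :
    Function.Injective (vertexImage f) := by
  intro p q hpq
  by_contra hne
  exact hf.not_isVertex _ _ (fun h => hne (vertexPt_injective h)) (planeToComplex_injective hpq)
    (isVertex_vertexPt p)

theorem IsPlaneGenericImmersion.edgeCurve_ne_vertexImage (hf : IsPlaneGenericImmersion f)
    (h : G.Adj u v) {w : V} (hu : u ≠ w) (hv : v ≠ w) (t : ℝ) :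
    edgeCurve f h t ≠ vertexImage f w := by
  intro he
  refine hf.not_isVertex (vertexPt G w) (edgePt h t) (fun hw => ?_) (planeToComplex_injective he).symm
    (isVertex_vertexPt w)
  have := edgePt_apply_of_ne h t hu.symm hv.symm
  rw [← hw] at this
  simp [vertexPt] at this

/-- The parities of the numbers of crossings of disjoint edges, in terms of parities attached to
the pairs of an edge and a vertex. -/
theorem IsPlaneGenericImmersion.exists_ncard_edgeCrossings_eq (hf : IsPlaneGenericImmersion f)
    {κ : V → ℕ} (hκ : Function.Injective κ) :
    ∃ n : V → V → V → ZMod 2, ∀ {u v c d : V} (h : G.Adj u v) (h' : G.Adj c d),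
      u ≠ c → u ≠ d → v ≠ c → v ≠ d →
      ((edgeCrossings f h h').ncard : ZMod 2) =
        n u v c + n u v d + n c d u + n c d v +
          ((if κ u < κ c then 0 else 1) + (if κ u < κ d then 0 else 1) +
            (if κ v < κ c then 0 else 1) + (if κ v < κ d then 0 else 1)) := by
  have hl : ∀ p q : V, p ≠ q → Complex.exp (Real.pi * Complex.I *
      (Complex.log (vertexImage f p - vertexImage f q) / (Real.pi * Complex.I))) =
      vertexImage f p - vertexImage f q := by
    intro p q hpq
    rw [mul_div_cancel₀ _ pi_mul_I_ne_zero, Complex.exp_log]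
    exact sub_ne_zero.2 fun h => hpq (hf.vertexImage_injective h)
  -- Swapping `p` and `q` changes the sign of the difference, hence shifts its logarithm by an odd
  -- number. Choosing the logarithm freely for one order only makes this shift 1 or -1 according to
  -- the numbering.
  obtain ⟨L, hL, hLsymm⟩ : ∃ L : V → V → ℂ,
      (∀ p q, p ≠ q → Complex.exp (Real.pi * Complex.I * L p q) =
        vertexImage f p - vertexImage f q) ∧
      ∀ p q, p ≠ q → L q p = L p q + 1 - 2 * ((if κ p < κ q then 0 else 1 : ℤ) : ℂ) := by
    refine ⟨fun p q => if κ p < κ q then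
      Complex.log (vertexImage f p - vertexImage f q) / (Real.pi * Complex.I) else
      Complex.log (vertexImage f q - vertexImage f p) / (Real.pi * Complex.I) + 1,
      fun p q hpq => ?_, fun p q hpq => ?_⟩
    · dsimp only
      split_ifs
      · exact hl p q hpq
      · rw [exp_pi_add_one, hl q p hpq.symm, neg_sub]
    · rcases lt_or_gt_of_ne (hκ.ne hpq) with hlt | hlt
      · simp [hlt, hlt.not_gt]
      · simp only [hlt, hlt.not_gt, if_true, if_false]
        push_cast
        ring
  have hn : ∀ u v w : V, ∃ n : ℤ, ∀ h : G.Adj u v, u ≠ w → v ≠ w →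
      logVar (fun s => edgeCurve f h s - vertexImage f w) 0 1 = L v w - L u w + 2 * n := by
    intro u v w
    by_cases hc : G.Adj u v ∧ u ≠ w ∧ v ≠ w
    · obtain ⟨h, hu, hv⟩ := hc
      obtain ⟨n, hn⟩ := exists_logVar_eq (F := fun s => edgeCurve f h s - vertexImage f w)
        zero_le_one ((hf.continuous_edgeCurve h).sub continuous_const).continuousOn
        (fun t _ => sub_ne_zero.2 (hf.edgeCurve_ne_vertexImage h hu hv t))
        (x := L u w) (y := L v w) (by rw [hL u w hu, edgeCurve, edgePt_zero, vertexImage])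
        (by rw [hL v w hv, edgeCurve, edgePt_one, vertexImage])
      exact ⟨n, fun _ _ _ => hn⟩
    -- Default value for triples that are not an edge and a vertex off it.
    · exact ⟨0, fun h hu hv => absurd ⟨h, hu, hv⟩ hc⟩
  choose n hn using hn
  refine ⟨fun u v w => n u v w, fun {u v c d} h h' huc hud hvc hvd => ?_⟩
  obtain ⟨m, hm, hw⟩ := hf.exists_winding_eq_ncard h h' huc hud hvc hvd
  have hneg : ∀ p, c ≠ p → d ≠ p → logVar (fun t => vertexImage f p - edgeCurve f h' t) 0 1 =
      L d p - L c p + 2 * n c d p := by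
    intro p hc hd
    rw [← hn c d p h' hc hd, ← logVar_neg zero_le_one]
    · simp only [neg_sub]
    · exact (continuous_const.sub (hf.continuous_edgeCurve h')).continuousOn
    · exact fun t _ => sub_ne_zero.2 (hf.edgeCurve_ne_vertexImage h' hc hd t).symm
  have e0 : edgeCurve f h 0 = vertexImage f u := by rw [edgeCurve, edgePt_zero, vertexImage]
  have e1 : edgeCurve f h 1 = vertexImage f v := by rw [edgeCurve, edgePt_one, vertexImage]
  have e0' : edgeCurve f h' 0 = vertexImage f c := by rw [edgeCurve, edgePt_zero, vertexImage]
  have e1' : edgeCurve f h' 1 = vertexImage f d := by rw [edgeCurve, edgePt_one, vertexImage]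
  simp only [winding, e0, e1, e0', e1'] at hw
  rw [hn u v c h huc hvc, hn u v d h hud hvd, hneg v hvc.symm hvd.symm, hneg u huc.symm hud.symm,
    hLsymm u c huc, hLsymm u d hud, hLsymm v c hvc, hLsymm v d hvd] at hw
  -- All values of `L` cancel, as do the four shifts by 1; only the order corrections survive
  -- besides the edge-vertex integers.
  have key : m = n u v c + n c d v - n u v d - n c d u +
      ((if κ v < κ c then 0 else 1) - (if κ u < κ c then 0 else 1) -
        (if κ v < κ d then 0 else 1) + (if κ u < κ d then 0 else 1)) := by
    have : (m : ℂ) = ((n u v c + n c d v - n u v d - n c d u +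
      ((if κ v < κ c then 0 else 1) - (if κ u < κ c then 0 else 1) -
        (if κ v < κ d then 0 else 1) + (if κ u < κ d then 0 else 1)) : ℤ) : ℂ) := by
      push_cast at hw ⊢
      linear_combination (-1 / 2 : ℂ) * hw
    exact_mod_cast this
  rw [← hm, key]
  push_cast
  simp only [CharTwo.sub_eq_add]
  ring

end

/-! ### Close pairs of edges in the Petersen graph -/

/-- A numbering of the vertices of the Petersen graph. -/
def vertexIndex : ZMod 5 ⊕ ZMod 5 → ℕ
  | Sum.inl i => i.val
  | Sum.inr i => 5 + i.val

theorem vertexIndex_injective : Function.Injective vertexIndex := by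
  decide +kernel

/-- The edges `u i — u (i+1)`, then `u i — v i`, then `v i — v (i+2)`. -/
def edgeEnds (i : Fin 15) : (ZMod 5 ⊕ ZMod 5) × (ZMod 5 ⊕ ZMod 5) :=
  -- The cast to `ZMod 5` reduces the index, so no offset is subtracted in the later cases.
  if i.val < 5 then (Sum.inl i.val, Sum.inl (i.val + 1))
  else if i.val < 10 then (Sum.inl i.val, Sum.inr i.val)
  else (Sum.inr i.val, Sum.inr (i.val + 2))

/-- The position of an edge in the numbering `edgeEnds`. -/
def edgeIndex : ZMod 5 ⊕ ZMod 5 → ZMod 5 ⊕ ZMod 5 → ℕ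
  | Sum.inl i, Sum.inl j => if j = i + 1 then i.val else j.val
  | Sum.inl i, Sum.inr _ => 5 + i.val
  | Sum.inr i, Sum.inl _ => 5 + i.val
  | Sum.inr i, Sum.inr j => if j = i + 2 then 10 + i.val else 10 + j.val

instance : DecidableRel petersen.Adj := fun a b =>
  match a, b with
  | Sum.inl i, Sum.inl j => inferInstanceAs (Decidable (j = i + 1 ∨ i = j + 1))
  | Sum.inl i, Sum.inr j => inferInstanceAs (Decidable (i = j))
  | Sum.inr i, Sum.inl j => inferInstanceAs (Decidable (i = j))
  | Sum.inr i, Sum.inr j => inferInstanceAs (Decidable (j = i + 2 ∨ i = j + 2))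

theorem adj_edgeEnds (i : Fin 15) : petersen.Adj (edgeEnds i).1 (edgeEnds i).2 := by
  revert i
  decide +kernel

theorem edgeIndex_edgeEnds (i : Fin 15) : edgeIndex (edgeEnds i).1 (edgeEnds i).2 = i := by
  revert i
  decide +kernel

theorem edgeIndex_comm {a b : ZMod 5 ⊕ ZMod 5} (h : petersen.Adj a b) :
    edgeIndex a b = edgeIndex b a := by
  revert a b
  decide +kernel

theorem exists_edgeEnds_eq {a b : ZMod 5 ⊕ ZMod 5} (h : petersen.Adj a b) :
    ∃ i : Fin 15, edgeIndex a b = i ∧ (edgeEnds i = (a, b) ∨ edgeEnds i = (b, a)) := by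
  revert a b
  decide +kernel

/-- Two edges of the Petersen graph are close if they are disjoint and joined by an edge. -/
def Close (i j : Fin 15) : Prop :=
  ((edgeEnds i).1 ≠ (edgeEnds j).1 ∧ (edgeEnds i).1 ≠ (edgeEnds j).2 ∧
    (edgeEnds i).2 ≠ (edgeEnds j).1 ∧ (edgeEnds i).2 ≠ (edgeEnds j).2) ∧
  (petersen.Adj (edgeEnds i).1 (edgeEnds j).1 ∨ petersen.Adj (edgeEnds i).1 (edgeEnds j).2 ∨
    petersen.Adj (edgeEnds i).2 (edgeEnds j).1 ∨ petersen.Adj (edgeEnds i).2 (edgeEnds j).2)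

instance : DecidableRel Close := fun i j => by
  unfold Close
  infer_instance

/-- The unordered pairs of close edges. -/
def closePairs : Finset (Fin 15 × Fin 15) :=
  Finset.univ.filter fun p => p.1 < p.2 ∧ Close p.1 p.2

/-- How often, modulo `2`, the edge `i` and the vertex `w` occur in a pair of edges. -/
def incidence (i : Fin 15) (w : ZMod 5 ⊕ ZMod 5) (p : Fin 15 × Fin 15) : ZMod 2 :=
  (if (i, w) = (p.1, (edgeEnds p.2).1) then 1 else 0) +
    (if (i, w) = (p.1, (edgeEnds p.2).2) then 1 else 0) +
    (if (i, w) = (p.2, (edgeEnds p.1).1) then 1 else 0) +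
    (if (i, w) = (p.2, (edgeEnds p.1).2) then 1 else 0)

/-- A vertex `w` off the edge `i` lies on exactly two edges close to `i`: if `w` is adjacent to an
end of `i`, the other two edges at `w`; otherwise the two edges from `w` to neighbours of the ends.
A vertex of `i` lies on none. -/
theorem sum_incidence_closePairs (i : Fin 15) (w : ZMod 5 ⊕ ZMod 5) :
    ∑ p ∈ closePairs, incidence i w p = 0 := by
  revert i w
  decide +kernel

theorem sum_closePairs_eq_zero (g : Fin 15 × (ZMod 5 ⊕ ZMod 5) → ZMod 2) :
    ∑ p ∈ closePairs, (g (p.1, (edgeEnds p.2).1) + g (p.1, (edgeEnds p.2).2) +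
      g (p.2, (edgeEnds p.1).1) + g (p.2, (edgeEnds p.1).2)) = 0 := by
  have h : ∀ p : Fin 15 × Fin 15, g (p.1, (edgeEnds p.2).1) + g (p.1, (edgeEnds p.2).2) +
      g (p.2, (edgeEnds p.1).1) + g (p.2, (edgeEnds p.1).2) =
      ∑ x, g x * incidence x.1 x.2 p := by
    intro p
    simp only [incidence, Prod.mk.eta, mul_add, mul_ite, mul_one, mul_zero, Finset.sum_add_distrib,
      Finset.sum_ite_eq', Finset.mem_univ, if_true]
  simp_rw [h]
  rw [Finset.sum_comm]
  simp_rw [← Finset.mul_sum, sum_incidence_closePairs, mul_zero, Finset.sum_const_zero]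

/-- A summand is 1 exactly when exactly one end of one edge lies between the ends of the other. So
this counts, modulo 2, the crossings of close edges when the vertices are in convex position in this
order and the edges are straight chords. -/
theorem sum_closePairs_vertexIndex :
    ∑ p ∈ closePairs,
      ((if vertexIndex (edgeEnds p.1).1 < vertexIndex (edgeEnds p.2).1 then 0 else 1) +
        (if vertexIndex (edgeEnds p.1).1 < vertexIndex (edgeEnds p.2).2 then 0 else 1) +
        (if vertexIndex (edgeEnds p.1).2 < vertexIndex (edgeEnds p.2).1 then 0 else 1) +
        (if vertexIndex (edgeEnds p.1).2 < vertexIndex (edgeEnds p.2).2 then 0 else 1)) =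
      (1 : ZMod 2) := by
  decide +kernel

/-- The number of crossings of close edges is odd. -/
theorem IsPlaneGenericImmersion.sum_closePairs_ncard_edgeCrossings
    {f : Space petersen → EuclideanSpace ℝ (Fin 2)} (hf : IsPlaneGenericImmersion f) :
    ∑ p ∈ closePairs,
      ((edgeCrossings f (adj_edgeEnds p.1) (adj_edgeEnds p.2)).ncard : ZMod 2) = 1 := by
  obtain ⟨n, hn⟩ := hf.exists_ncard_edgeCrossings_eq vertexIndex_injective
  have h : ∀ p ∈ closePairs, _ := fun p hp =>
    have hd := (Finset.mem_filter.1 hp).2.2.1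
    hn (adj_edgeEnds p.1) (adj_edgeEnds p.2) hd.1 hd.2.1 hd.2.2.1 hd.2.2.2
  rw [Finset.sum_congr rfl h, Finset.sum_add_distrib, sum_closePairs_vertexIndex,
    sum_closePairs_eq_zero fun x => n (edgeEnds x.1).1 (edgeEnds x.1).2 x.2, zero_add]

/-! ### Enumeration of the cycles by bit masks -/

/-- The vertices of the Petersen graph. -/
def vertexList : List (ZMod 5 ⊕ ZMod 5) :=
  [0, 1, 2, 3, 4].map Sum.inl ++ [0, 1, 2, 3, 4].map Sum.inr

theorem mem_vertexList (a : ZMod 5 ⊕ ZMod 5) : a ∈ vertexList := by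
  rcases a with i | i <;> simp [vertexList] <;> revert i <;> decide +kernel

/-- The neighbours of a vertex of the Petersen graph. -/
def neighborList (a : ZMod 5 ⊕ ZMod 5) : List (ZMod 5 ⊕ ZMod 5) :=
  vertexList.filter fun b => petersen.Adj a b

theorem mem_neighborList {a b : ZMod 5 ⊕ ZMod 5} : b ∈ neighborList a ↔ petersen.Adj a b := by
  simp [neighborList, mem_vertexList]

/-- The set of vertices of a walk, as a bit mask. -/
def vertexMask {a b : ZMod 5 ⊕ ZMod 5} : petersen.Walk a b → ℕ
  | .nil => 2 ^ vertexIndex a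
  | .cons _ p => vertexMask p ||| 2 ^ vertexIndex a

/-- The set of edges of a walk, as a bit mask. -/
def edgeMask {a b : ZMod 5 ⊕ ZMod 5} : petersen.Walk a b → ℕ
  | .nil => 0
  | .cons (v := c) _ p => edgeMask p ||| 2 ^ edgeIndex a c

theorem testBit_vertexMask {a b : ZMod 5 ⊕ ZMod 5} (p : petersen.Walk a b) (c : ZMod 5 ⊕ ZMod 5) :
    (vertexMask p).testBit (vertexIndex c) = true ↔ c ∈ p.support := by
  induction p with
  | nil =>
    rw [vertexMask, Nat.testBit_two_pow, decide_eq_true_iff, vertexIndex_injective.eq_iff]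
    simp [eq_comm]
  | cons h p ih =>
    rw [vertexMask, Nat.testBit_or, Bool.or_eq_true, ih, Nat.testBit_two_pow, decide_eq_true_iff,
      vertexIndex_injective.eq_iff, SimpleGraph.Walk.support_cons, List.mem_cons, or_comm, eq_comm]

theorem edgeIndex_eq_iff {a b c d : ZMod 5 ⊕ ZMod 5} (h : petersen.Adj a b)
    (h' : petersen.Adj c d) : edgeIndex a b = edgeIndex c d ↔ s(a, b) = s(c, d) := by
  constructor
  · intro he
    obtain ⟨i, hi, hab⟩ := exists_edgeEnds_eq h
    obtain ⟨j, hj, hcd⟩ := exists_edgeEnds_eq h'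
    obtain rfl : i = j := Fin.ext (by omega)
    rw [Sym2.eq_iff]
    grind
  · intro he
    rcases Sym2.eq_iff.1 he with ⟨rfl, rfl⟩ | ⟨rfl, rfl⟩
    · rfl
    · exact edgeIndex_comm h

theorem testBit_edgeMask {a b c d : ZMod 5 ⊕ ZMod 5} (p : petersen.Walk a b)
    (h : petersen.Adj c d) :
    (edgeMask p).testBit (edgeIndex c d) = true ↔ s(c, d) ∈ p.edges := by
  induction p with
  | nil => simp [edgeMask]
  | cons h' p ih =>
    rw [edgeMask, Nat.testBit_or, Bool.or_eq_true, ih, Nat.testBit_two_pow, decide_eq_true_iff,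
      edgeIndex_eq_iff h' h, SimpleGraph.Walk.edges_cons, List.mem_cons, or_comm, eq_comm]

/-- The paths of length `n` from a given vertex: their end points, vertices and edges. -/
def pathData : ℕ → ZMod 5 ⊕ ZMod 5 → List ((ZMod 5 ⊕ ZMod 5) × ℕ × ℕ)
  | 0, a => [(a, 2 ^ vertexIndex a, 0)]
  | n + 1, a => (neighborList a).flatMap fun c =>
    ((pathData n c).filter fun x => !x.2.1.testBit (vertexIndex a)).map fun x =>
      (x.1, x.2.1 ||| 2 ^ vertexIndex a, x.2.2 ||| 2 ^ edgeIndex a c)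

theorem mem_pathData {n : ℕ} {a : ZMod 5 ⊕ ZMod 5} {x : (ZMod 5 ⊕ ZMod 5) × ℕ × ℕ} :
    x ∈ pathData n a ↔ ∃ p : petersen.Walk a x.1,
      p.IsPath ∧ p.length = n ∧ x.2 = (vertexMask p, edgeMask p) := by
  induction n generalizing a x with
  | zero =>
    obtain ⟨b, m, m'⟩ := x
    simp only [pathData, List.mem_singleton]
    constructor
    · rintro ⟨⟩
      exact ⟨.nil, by simp, rfl, rfl⟩
    · rintro ⟨p, -, hl, hx⟩
      cases p with
      | nil => rw [hx]; rfl
      | cons h p => simp at hl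
  | succ n ih =>
    simp only [pathData, List.mem_flatMap, List.mem_map, List.mem_filter, mem_neighborList, ih,
      Bool.not_eq_true', ← Bool.not_eq_true]
    constructor
    · rintro ⟨c, hc, ⟨b, m⟩, ⟨⟨p, hp, hl, hm⟩, hv⟩, rfl⟩
      dsimp only at p hp hl hm hv
      subst hm
      rw [testBit_vertexMask] at hv
      exact ⟨.cons hc p, (SimpleGraph.Walk.cons_isPath_iff _ _).2 ⟨hp, hv⟩,
        by rw [SimpleGraph.Walk.length_cons, hl], rfl⟩
    · rintro ⟨p, hp, hl, hx⟩
      obtain ⟨b, m⟩ := x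
      dsimp only at p hp hl hx
      cases p with
      | nil => simp at hl
      | cons h p =>
        rw [SimpleGraph.Walk.cons_isPath_iff] at hp
        refine ⟨_, h, (b, vertexMask p, edgeMask p), ⟨⟨p, hp.1, ?_, rfl⟩, ?_⟩, ?_⟩
        · simpa using hl
        · rw [testBit_vertexMask]
          exact hp.2
        · rw [hx]
          rfl

/-- The edge sets of the cycles of length `n + 1`, as bit masks. -/
def cycleMasks (n : ℕ) : List ℕ :=
  (vertexList.flatMap fun a => (neighborList a).flatMap fun c =>
    ((pathData n c).filter fun x => decide (x.1 = a) && !x.2.2.testBit (edgeIndex a c)).map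
      fun x => x.2.2 ||| 2 ^ edgeIndex a c).dedup

/-- A cycle is a first edge followed by a path back that avoids this edge. It is found once for each
base point and direction, hence the `dedup`. -/
theorem mem_cycleMasks {n m : ℕ} : m ∈ cycleMasks n ↔
    ∃ (a : ZMod 5 ⊕ ZMod 5) (p : petersen.Walk a a), p.IsCycle ∧ p.length = n + 1 ∧
      m = edgeMask p := by
  rw [cycleMasks, List.mem_dedup, List.mem_flatMap]
  simp only [mem_vertexList, true_and, List.mem_flatMap, List.mem_map, List.mem_filter, mem_neighborList,
    mem_pathData, Bool.and_eq_true, decide_eq_true_iff, Bool.not_eq_true', ← Bool.not_eq_true]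
  constructor
  · rintro ⟨a, c, hc, ⟨b, m⟩, ⟨⟨p, hp, hl, hm⟩, hb, hv⟩, rfl⟩
    dsimp only at p hp hl hm hb hv
    subst hm hb
    rw [testBit_edgeMask p hc] at hv
    exact ⟨b, .cons hc p, (SimpleGraph.Walk.cons_isCycle_iff _ _).2 ⟨hp, hv⟩,
      by rw [SimpleGraph.Walk.length_cons, hl], rfl⟩
  · rintro ⟨a, p, hp, hl, rfl⟩
    cases p with
    | nil => simp at hl
    | cons h p =>
      rw [SimpleGraph.Walk.cons_isCycle_iff] at hp
      refine ⟨a, _, h, (a, vertexMask p, edgeMask p), ⟨⟨p, hp.1, ?_, rfl⟩, rfl, ?_⟩, rfl⟩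
      · simpa using hl
      · rw [testBit_edgeMask p h]
        exact hp.2

/-- The subgraph of the Petersen graph without isolated vertices that has the given edges. -/
def maskSubgraph (m : ℕ) : petersen.Subgraph where
  verts := {a | ∃ b, petersen.Adj a b ∧ m.testBit (edgeIndex a b) = true}
  Adj a b := petersen.Adj a b ∧ m.testBit (edgeIndex a b) = true
  adj_sub h := h.1
  edge_vert h := ⟨_, h⟩
  symm := ⟨fun _ _ h => ⟨h.1.symm, edgeIndex_comm h.1 ▸ h.2⟩⟩

/-- Every vertex of a walk with at least one edge lies on one of its edges, so the edges determine
the subgraph. -/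
theorem toSubgraph_eq_maskSubgraph {a b : ZMod 5 ⊕ ZMod 5} (p : petersen.Walk a b) (hp : ¬ p.Nil) :
    p.toSubgraph = maskSubgraph (edgeMask p) := by
  have hadj : ∀ c d, p.toSubgraph.Adj c d ↔ (maskSubgraph (edgeMask p)).Adj c d := by
    intro c d
    rw [SimpleGraph.Walk.adj_toSubgraph_iff_mem_edges]
    constructor
    · intro h
      exact ⟨p.adj_of_mem_edges h, (testBit_edgeMask p (p.adj_of_mem_edges h)).2 h⟩
    · rintro ⟨h, h'⟩
      exact (testBit_edgeMask p h).1 h'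
  refine SimpleGraph.Subgraph.ext ?_ (by ext c d; exact hadj c d)
  ext c
  rw [SimpleGraph.Walk.mem_verts_toSubgraph,
    SimpleGraph.Walk.mem_support_iff_exists_mem_edges_of_not_nil hp]
  constructor
  · rintro ⟨e, he, hc⟩
    obtain ⟨d, rfl⟩ := hc
    exact ⟨d, (hadj c d).1 (SimpleGraph.Walk.adj_toSubgraph_iff_mem_edges.2 he)⟩
  · rintro ⟨d, hd⟩
    exact ⟨s(c, d), SimpleGraph.Walk.adj_toSubgraph_iff_mem_edges.1 ((hadj c d).2 hd),
      Sym2.mem_mk_left c d⟩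

open Classical in
theorem cycles_eq_image (n : ℕ) :
    cycles petersen (n + 1) = (cycleMasks n).toFinset.image maskSubgraph := by
  ext H
  simp only [cycles, Set.Finite.mem_toFinset, Set.mem_ofPred_eq, Finset.mem_image,
    List.mem_toFinset, mem_cycleMasks]
  constructor
  · rintro ⟨a, p, hp, hl, rfl⟩
    exact ⟨_, ⟨a, p, hp, hl, rfl⟩, (toSubgraph_eq_maskSubgraph p hp.not_nil).symm⟩
  · rintro ⟨_, ⟨a, p, hp, hl, rfl⟩, rfl⟩
    exact ⟨a, p, hp, hl, (toSubgraph_eq_maskSubgraph p hp.not_nil).symm⟩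

theorem maskSubgraph_adj_edgeEnds (m : ℕ) (i : Fin 15) :
    (maskSubgraph m).Adj (edgeEnds i).1 (edgeEnds i).2 ↔ m.testBit i = true := by
  change _ ∧ _ ↔ _
  rw [edgeIndex_edgeEnds]
  exact and_iff_right (adj_edgeEnds i)

theorem edgeMask_lt {a b : ZMod 5 ⊕ ZMod 5} (p : petersen.Walk a b) : edgeMask p < 2 ^ 15 := by
  induction p with
  | nil => simp [edgeMask]
  | cons h p ih =>
    obtain ⟨i, hi, -⟩ := exists_edgeEnds_eq h
    exact Nat.or_lt_two_pow ih (Nat.pow_lt_pow_right (by simp) (by omega))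

theorem injOn_maskSubgraph (n : ℕ) :
    Set.InjOn maskSubgraph ((cycleMasks n).toFinset : Set ℕ) := by
  have hlt : ∀ m ∈ ((cycleMasks n).toFinset : Set ℕ), m < 2 ^ 15 := by
    intro m hm
    obtain ⟨a, p, -, -, rfl⟩ := mem_cycleMasks.1 (List.mem_toFinset.1 hm)
    exact edgeMask_lt p
  intro m hm m' hm' h
  refine Nat.eq_of_testBit_eq fun i => ?_
  by_cases hi : i < 15
  · rw [Bool.eq_iff_iff, ← maskSubgraph_adj_edgeEnds m ⟨i, hi⟩, h, maskSubgraph_adj_edgeEnds]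
  · have hle : 2 ^ 15 ≤ 2 ^ i := Nat.pow_le_pow_right (by simp) (not_lt.1 hi)
    rw [Nat.testBit_lt_two_pow ((hlt m hm).trans_le hle),
      Nat.testBit_lt_two_pow ((hlt m' hm').trans_le hle)]

/-- The number of cycles of length `n + 1` through two given edges. -/
def cycleCount (n : ℕ) (i j : Fin 15) : ℕ :=
  ((cycleMasks n).toFinset.filter fun m => m.testBit i = true ∧ m.testBit j = true).card

/-- Evaluated once, so that the checks over all pairs of edges run on explicit lists. There are 12,
10, 15 and 20 cycles of lengths 5, 6, 8 and 9. -/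
theorem cycleMasks_four : cycleMasks 4 =
    [31, 1187, 8504, 9604, 10337, 2374, 16977, 19208, 20674, 4748, 5680, 31744] := by
  decide +kernel

theorem cycleMasks_five : cycleMasks 5 =
    [1212, 8487, 2393, 11458, 16974, 27184, 4755, 22916, 21601, 14088] := by
  decide +kernel

theorem cycleMasks_seven : cycleMasks 7 =
    [9627, 3557, 10366, 25449, 18162, 19223, 28300, 30883, 7114, 20701, 13236, 5679, 23864, 30022,
    15953] := by
  decide +kernel

theorem cycleMasks_eight : cycleMasks 8 =
    [11485, 3578, 18157, 25462, 26570, 20404, 27183, 28307, 22939, 13227, 15090, 30908, 29157, 7125,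
    23847, 8041, 21630, 14103, 30041, 15950] := by
  decide +kernel

/-- The count is 4 for equal, 2 for adjacent and 1 for close edges, and 0 for the remaining pairs,
since non-adjacent edges of a 5-cycle are joined by an edge of it. -/
theorem cycleCount_four (i j : Fin 15) : cycleCount 4 i j % 2 = if Close i j then 1 else 0 := by
  rw [cycleCount, cycleMasks_four]
  revert i j
  decide +kernel

theorem cycleCount_five (i j : Fin 15) : cycleCount 5 i j % 2 = if Close i j then 1 else 0 := by
  rw [cycleCount, cycleMasks_five]
  revert i j
  decide +kernel

/-- No pair of edges is distinguished modulo 4, so the statement on 8-cycles needs no winding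
numbers. -/
theorem cycleCount_seven (i j : Fin 15) : cycleCount 7 i j % 4 = 0 := by
  rw [cycleCount, cycleMasks_seven]
  revert i j
  decide +kernel

theorem cycleCount_eight (i j : Fin 15) : cycleCount 8 i j % 2 = if Close i j then 1 else 0 := by
  rw [cycleCount, cycleMasks_eight]
  revert i j
  decide +kernel

/-! ### From crossings to pairs of edges -/

section

variable {V : Type*} [DecidableEq V] {G : SimpleGraph V} {u v : V}

theorem exists_edgePt_eq (h : G.Adj u v) {x : V → ℝ}
    (hx : x ∈ segment ℝ (Pi.single u 1 : V → ℝ) (Pi.single v 1)) :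
    ∃ t ∈ Icc (0 : ℝ) 1, (edgePt h t).1 = x := by
  rw [segment_eq_image_lineMap] at hx
  obtain ⟨t, ht, rfl⟩ := hx
  exact ⟨t, ht, edgePt_val h ht⟩

theorem edgePt_mem_space (h : G.Adj u v) {H : G.Subgraph} (hH : H.Adj u v) (t : ℝ) :
    (edgePt h t).1 ∈ space H := by
  refine Or.inr ⟨u, v, hH, ?_⟩
  rw [edgePt_coe, segment_eq_image_lineMap]
  exact mem_image_of_mem _ (projIcc 0 1 zero_le_one t).2

/-- An interior point of `uv` has nonzero coordinates at both `u` and `v`, which excludes vertices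
and all other edges. -/
theorem edgePt_mem_space_iff (h : G.Adj u v) {H : G.Subgraph} {t : ℝ} (ht : t ∈ Ioo (0 : ℝ) 1) :
    (edgePt h t).1 ∈ space H ↔ H.Adj u v := by
  refine ⟨fun hx => ?_, fun hH => edgePt_mem_space h hH t⟩
  have hu : (edgePt h t).1 u ≠ 0 := by
    rw [edgePt_apply_left h (Ioo_subset_Icc_self ht)]
    linarith [ht.2]
  have hv : (edgePt h t).1 v ≠ 0 := by
    rw [edgePt_apply_right h (Ioo_subset_Icc_self ht)]
    exact ht.1.ne'
  rcases hx with ⟨w, -, hw⟩ | ⟨a, b, hab, hx⟩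
  · rw [hw] at hu hv
    exact absurd ((not_not.1 fun h => hu (Pi.single_eq_of_ne h 1)).trans
      (not_not.1 fun h => hv (Pi.single_eq_of_ne h 1)).symm) h.ne
  · obtain ⟨t', -, ht'⟩ := exists_edgePt_eq hab.adj_sub hx
    rw [← ht'] at hu hv
    have hu' : u = a ∨ u = b := by
      by_contra hn
      rw [not_or] at hn
      exact hu (edgePt_apply_of_ne _ _ hn.1 hn.2)
    have hv' : v = a ∨ v = b := by
      by_contra hn
      rw [not_or] at hn
      exact hv (edgePt_apply_of_ne _ _ hn.1 hn.2)
    have huv := h.ne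
    rcases hu' with rfl | rfl <;> rcases hv' with rfl | rfl
    · exact absurd rfl huv
    · exact hab
    · exact hab.symm
    · exact absurd rfl huv

theorem edgePt_mem_Ioo_of_not_isVertex (h : G.Adj u v) {t : ℝ} (ht : t ∈ Icc (0 : ℝ) 1)
    (hn : ¬ IsVertex (edgePt h t)) : t ∈ Ioo (0 : ℝ) 1 := by
  refine ⟨lt_of_le_of_ne ht.1 ?_, lt_of_le_of_ne ht.2 ?_⟩ <;> rintro rfl
  · exact hn (edgePt_zero h ▸ isVertex_vertexPt u)
  · exact hn (edgePt_one h ▸ isVertex_vertexPt v)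

theorem IsPlaneGenericImmersion.eq_and_eq_or {f : Space G → EuclideanSpace ℝ (Fin 2)}
    (hf : IsPlaneGenericImmersion f) {x x' z z' : Space G} (hx : x ≠ x') (hz : z ≠ z')
    (hxx : f x' = f x) (hxz : f z = f x) (hxz' : f z' = f x) :
    (z = x ∧ z' = x') ∨ (z = x' ∧ z' = x) := by
  obtain ⟨p, q, -, hset⟩ := ncard_eq_two.1 (hf.double (f x) ⟨x, rfl, x', hxx, hx⟩)
  have h1 : x ∈ f ⁻¹' {f x} := rfl
  have h2 : x' ∈ f ⁻¹' {f x} := hxx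
  have h3 : z ∈ f ⁻¹' {f x} := hxz
  have h4 : z' ∈ f ⁻¹' {f x} := hxz'
  rw [hset] at h1 h2 h3 h4
  simp only [mem_insert_iff, mem_singleton_iff] at h1 h2 h3 h4
  grind

end

theorem exists_eq_edgePt_of_not_isVertex {x : Space petersen} (hx : ¬ IsVertex x) :
    ∃ i, ∃ t ∈ Ioo (0 : ℝ) 1, x = edgePt (adj_edgeEnds i) t := by
  rcases x.2 with ⟨w, -, hw⟩ | ⟨a, b, hab, hseg⟩
  · exact absurd ⟨w, hw⟩ hx
  · obtain ⟨i, -, hi⟩ := exists_edgeEnds_eq hab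
    have hseg' : x.1 ∈ segment ℝ (Pi.single (edgeEnds i).1 1 : _ → ℝ)
        (Pi.single (edgeEnds i).2 1) := by
      rcases hi with hi | hi <;> rw [hi]
      · exact hseg
      · rwa [segment_symm]
    obtain ⟨t, ht, htx⟩ := exists_edgePt_eq (adj_edgeEnds i) hseg'
    obtain rfl : edgePt (adj_edgeEnds i) t = x := Subtype.ext htx
    exact ⟨i, t, edgePt_mem_Ioo_of_not_isVertex _ ht hx, rfl⟩

theorem eq_of_edgePt_eq {i j : Fin 15} {s t : ℝ} (hs : s ∈ Ioo (0 : ℝ) 1)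
    (h : edgePt (adj_edgeEnds i) s = edgePt (adj_edgeEnds j) t) : i = j := by
  have hmem : (edgePt (adj_edgeEnds i) s).1 ∈ space (petersen.subgraphOfAdj (adj_edgeEnds j)) := by
    rw [h]
    exact edgePt_mem_space _ (by simp) t
  rw [edgePt_mem_space_iff _ hs, SimpleGraph.subgraphOfAdj_adj] at hmem
  have := (edgeIndex_eq_iff (adj_edgeEnds j) (adj_edgeEnds i)).2 hmem
  rw [edgeIndex_edgeEnds, edgeIndex_edgeEnds] at this
  exact (Fin.ext this).symm

/-- The multiple points of a plane generic immersion of the Petersen graph and the pairs of edges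
which cross there. -/
theorem IsPlaneGenericImmersion.exists_crossing_edges
    {f : Space petersen → EuclideanSpace ℝ (Fin 2)} (hf : IsPlaneGenericImmersion f) :
    ∃ (C : Finset (EuclideanSpace ℝ (Fin 2))) (k : EuclideanSpace ℝ (Fin 2) → Fin 15 × Fin 15),
      (∀ y ∈ C, (k y).1 ≤ (k y).2) ∧
      (∀ H : petersen.Subgraph, {y | ∃ x x' : Space petersen, x.1 ∈ space H ∧ x'.1 ∈ space H ∧
        x ≠ x' ∧ f x = y ∧ f x' = y} =
        {y | y ∈ C ∧ H.Adj (edgeEnds (k y).1).1 (edgeEnds (k y).1).2 ∧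
          H.Adj (edgeEnds (k y).2).1 (edgeEnds (k y).2).2}) ∧
      ∀ p ∈ closePairs, edgeCrossings f (adj_edgeEnds p.1) (adj_edgeEnds p.2) =
        {y | y ∈ C ∧ k y = p} := by
  -- Ordering the two edges makes the pair comparable with the elements of `closePairs`; equality
  -- occurs when an edge crosses itself.
  have hex : ∀ y ∈ hf.finite_multiple.toFinset, ∃ p : Fin 15 × Fin 15, p.1 ≤ p.2 ∧
      ∃ s ∈ Ioo (0 : ℝ) 1, ∃ t ∈ Ioo (0 : ℝ) 1,
        edgePt (adj_edgeEnds p.1) s ≠ edgePt (adj_edgeEnds p.2) t ∧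
        f (edgePt (adj_edgeEnds p.1) s) = y ∧ f (edgePt (adj_edgeEnds p.2) t) = y := by
    intro y hy
    obtain ⟨x, hx, x', hx', hne⟩ := hf.finite_multiple.mem_toFinset.1 hy
    have hxx' : f x = f x' := Eq.trans hx (Eq.symm hx')
    obtain ⟨i, s, hs, rfl⟩ := exists_eq_edgePt_of_not_isVertex (hf.not_isVertex _ _ hne hxx')
    obtain ⟨j, t, ht, rfl⟩ :=
      exists_eq_edgePt_of_not_isVertex (hf.not_isVertex _ _ hne.symm hxx'.symm)
    rcases le_total i j with hij | hij
    · exact ⟨(i, j), hij, s, hs, t, ht, hne, hx, hx'⟩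
    · exact ⟨(j, i), hij, t, ht, s, hs, hne.symm, hx', hx⟩
  choose! k hle S hS T hT hne hkS hkT using hex
  refine ⟨hf.finite_multiple.toFinset, k, hle, fun H => ?_, fun p hp => ?_⟩
  · ext y
    constructor
    · rintro ⟨x, x', hx, hx', hxx', rfl, hy'⟩
      have hy : f x ∈ hf.finite_multiple.toFinset :=
        hf.finite_multiple.mem_toFinset.2 ⟨x, rfl, x', hy', hxx'⟩
      refine ⟨hy, ?_⟩
      rw [← edgePt_mem_space_iff (adj_edgeEnds (k (f x)).1) (hS _ hy),
        ← edgePt_mem_space_iff (adj_edgeEnds (k (f x)).2) (hT _ hy)]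
      rcases hf.eq_and_eq_or hxx' (hne _ hy) hy' (hkS _ hy) (hkT _ hy) with ⟨h1, h2⟩ | ⟨h1, h2⟩
      · rw [h1, h2]
        exact ⟨hx, hx'⟩
      · rw [h1, h2]
        exact ⟨hx', hx⟩
    · rintro ⟨hy, h1, h2⟩
      exact ⟨_, _, edgePt_mem_space _ h1 _, edgePt_mem_space _ h2 _, hne y hy, hkS y hy, hkT y hy⟩
  · obtain ⟨-, hlt, ⟨d1, d2, d3, d4⟩, -⟩ := Finset.mem_filter.1 hp
    ext y
    constructor
    · rintro ⟨s, hs, t, ht, rfl, hy'⟩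
      have hst := edgePt_ne_edgePt (adj_edgeEnds p.1) (adj_edgeEnds p.2) d1 d2 d3 d4 hs t
      have hy : f (edgePt (adj_edgeEnds p.1) s) ∈ hf.finite_multiple.toFinset :=
        hf.finite_multiple.mem_toFinset.2 ⟨_, rfl, _, hy', hst⟩
      refine ⟨hy, ?_⟩
      rcases hf.eq_and_eq_or hst (hne _ hy) hy' (hkS _ hy) (hkT _ hy) with ⟨h1, h2⟩ | ⟨h1, h2⟩
      · exact Prod.ext (eq_of_edgePt_eq (hS _ hy) h1) (eq_of_edgePt_eq (hT _ hy) h2)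
      · have e1 := eq_of_edgePt_eq (hS _ hy) h1
        have e2 := eq_of_edgePt_eq (hT _ hy) h2
        have := hle _ hy
        rw [e1, e2] at this
        exact absurd hlt this.not_gt
    · rintro ⟨hy, rfl⟩
      exact ⟨_, Ioo_subset_Icc_self (hS y hy), _, Ioo_subset_Icc_self (hT y hy), hkS y hy, hkT y hy⟩

open Classical in
-- Double counting of pairs of a cycle and a crossing on it.
theorem sum_crossings_cycles {f : Space petersen → EuclideanSpace ℝ (Fin 2)}
    {C : Finset (EuclideanSpace ℝ (Fin 2))} {k : EuclideanSpace ℝ (Fin 2) → Fin 15 × Fin 15}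
    (hC : ∀ H : petersen.Subgraph, {y | ∃ x x' : Space petersen, x.1 ∈ space H ∧ x'.1 ∈ space H ∧
        x ≠ x' ∧ f x = y ∧ f x' = y} =
        {y | y ∈ C ∧ H.Adj (edgeEnds (k y).1).1 (edgeEnds (k y).1).2 ∧
          H.Adj (edgeEnds (k y).2).1 (edgeEnds (k y).2).2}) (n : ℕ) :
    ∑ γ ∈ cycles petersen (n + 1), crossings f γ = ∑ y ∈ C, cycleCount n (k y).1 (k y).2 := by
  have hcr : ∀ m, crossings f (maskSubgraph m) =
      ∑ y ∈ C, if m.testBit (k y).1 = true ∧ m.testBit (k y).2 = true then 1 else 0 := by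
    intro m
    rw [crossings, hC, ← Finset.card_filter, ← ncard_coe_finset, Finset.coe_filter]
    simp only [maskSubgraph_adj_edgeEnds]
  rw [cycles_eq_image, Finset.sum_image (injOn_maskSubgraph n)]
  simp_rw [hcr, cycleCount, Finset.card_filter]
  exact Finset.sum_comm

theorem not_close_self (i : Fin 15) : ¬ Close i i := fun h => h.1.1 rfl

end PlaneGraph

open PlaneGraph in
theorem theorem1p5
    (f : PlaneGraph.Space PlaneGraph.petersen → EuclideanSpace ℝ (Fin 2))
    (hf : PlaneGraph.IsPlaneGenericImmersion f) :
    (∑ γ ∈ PlaneGraph.cycles PlaneGraph.petersen 5, PlaneGraph.crossings f γ) ≡ 1 [MOD 2] ∧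
    (∑ γ ∈ PlaneGraph.cycles PlaneGraph.petersen 6, PlaneGraph.crossings f γ) ≡ 1 [MOD 2] ∧
    (∑ γ ∈ PlaneGraph.cycles PlaneGraph.petersen 9, PlaneGraph.crossings f γ) ≡ 1 [MOD 2] ∧
    (∑ γ ∈ PlaneGraph.cycles PlaneGraph.petersen 8, PlaneGraph.crossings f γ) ≡ 0 [MOD 4] := by
  obtain ⟨C, k, hle, hC, hclose⟩ := hf.exists_crossing_edges
  -- Grouping the crossings by their pair of edges turns the oddness over close pairs into a sum
  -- over crossings.
  have hpairs : ∑ y ∈ C, (if Close (k y).1 (k y).2 then 1 else 0 : ZMod 2) = 1 := by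
    refine Eq.trans ?_ hf.sum_closePairs_ncard_edgeCrossings
    have hcard : ∀ p ∈ closePairs,
        ((edgeCrossings f (adj_edgeEnds p.1) (adj_edgeEnds p.2)).ncard : ZMod 2) =
          ∑ y ∈ C, if k y = p then 1 else 0 := by
      intro p hp
      rw [hclose p hp, ← Finset.natCast_card_filter, ← Set.ncard_coe_finset, Finset.coe_filter]
    rw [Finset.sum_congr rfl hcard, Finset.sum_comm]
    refine Finset.sum_congr rfl fun y hy => ?_
    rw [Finset.sum_ite_eq]
    refine if_congr ⟨fun h => ?_, fun h => (Finset.mem_filter.1 h).2.2⟩ rfl rfl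
    exact Finset.mem_filter.2 ⟨Finset.mem_univ _, lt_of_le_of_ne (hle y hy) fun he =>
      not_close_self _ (he ▸ h), h⟩
  have hodd : ∀ n, (∀ i j, cycleCount n i j % 2 = if Close i j then 1 else 0) →
      ∑ γ ∈ cycles petersen (n + 1), crossings f γ ≡ 1 [MOD 2] := by
    intro n hn
    rw [sum_crossings_cycles hC, ← ZMod.natCast_eq_natCast_iff, Nat.cast_sum, Nat.cast_one, ← hpairs]
    refine Finset.sum_congr rfl fun y _ => ?_
    rw [← ZMod.natCast_mod, hn]
    split_ifs <;> simp
  refine ⟨hodd 4 cycleCount_four, hodd 5 cycleCount_five, hodd 8 cycleCount_eight, ?_⟩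
  rw [sum_crossings_cycles hC, Nat.modEq_zero_iff_dvd]
  exact Finset.dvd_sum fun y _ => Nat.dvd_of_mod_eq_zero (cycleCount_seven _ _)
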